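/- Let $Q$ be a finite-dimensional smooth ($C^\infty$, Hausdorff, second countable) manifold and let $k\ge 1$. For $r\ge 0$ let $T^{(r)}Q$ be the $r$-th order tangent bundle, i.e. the manifold of classes $[\gamma]_0^{(r)}$ of smooth curves in $Q$ defined near $0$, two curves being equivalent if $\gamma_1(0)=\gamma_2(0)$ and their derivatives at $0$ up to order $r$ agree in a chart; a chart $(q^i)$ of $Q$ induces natural coordinates $(q^i_{(0)},\dots,q^i_{(r)})$ on $T^{(r)}Q$, the derivatives at $0$ of the coordinates of $\gamma$. Let $\tau\colon T^{(2k-1)}Q\to T^{(k-1)}Q$ be the canonical projection. The $r$-lift of a curve $\gamma$ in $Q$ is $\gamma^{(r)}(t)=[s\mapsto\gamma(t+s)]_0^{(r)}$, and $j_r\colon T^{(r)}Q\to T\,T^{(r-1)}Q$, $j_r([\gamma]_0^{(r)})=\frac{d}{dt}\big|_{t=0}\gamma^{(r-1)}(t)$, is the canonical immersion. For a function $f$ on $T^{(r)}Q$, let $d_Tf$ be the function $x\mapsto\langle df,j_{r+1}(x)\rangle$ on $T^{(r+1)}Q$. Let $L\in C^\infty(T^{(k)}Q)$ be a $k$-th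 order Lagrangian, regular or not. * The Legendre–Ostrogradsky map $\operatorname{leg}_L\colon T^{(2k-1)}Q\to T^*T^{(k-1)}Q$ is the map over $T^{(k-1)}Q$ determined by $\theta_L(u)=\langle \operatorname{leg}_L(x),T\tau(u)\rangle$ for all $x\in T^{(2k-1)}Q$ and $u\in T_xT^{(2k-1)}Q$, where $\theta_L$ is the Poincaré–Cartan form, $\theta_L=\sum_{i}\sum_{r=1}^{k}\hat p^{(r-1)}_i\,dq^i_{(r-1)}$ with $\hat p^{(r-1)}_i=\sum_{j=0}^{k-r}(-1)^j d_T^j\big(\partial L/\partial q^i_{(r+j)}\big)$ (pulled back to $T^{(2k-1)}Q$) in natural coordinates. * For a manifold $M$, $\alpha_M\colon TT^*M\to T^*TM$ is the Tulczyjew isomorphism, the dual of the canonical flip of $TTM$; in natural coordinates $\alpha_M(q,p,\dot q,\dot p)=(q,\dot q,\dot p,p)$. * $\Sigma_L=\{\mu\in T^*TT^{(k-1)}Q : j_k^*\mu=dL\}$, i.e. the set of those $\mu\in T^*_{j_k(x)}TT^{(k-1)}Q$, $x\in T^{(k)}Q$, with $\mu\circ T_xj_k=d_xL$. Let $I\subset\mathbb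 R$ be an open interval (more generally, an open set) and let $\gamma\colon I\to Q$ be a smooth curve. Then $\gamma$ is a solution of the $k$-th order Euler–Lagrange equations of $L$, i.e. in all natural coordinates $$\sum_{j=0}^{k}(-1)^j\frac{d^j}{dt^j}\left(\frac{\partial L}{\partial q^i_{(j)}}\big(\gamma^{(k)}(t)\big)\right)=0\qquad(1\le i\le \dim Q)$$ at every $t\in I$ for which $\gamma(t)$ lies in the domain of the chart, if and only if $$\alpha_{T^{(k-1)}Q}\left(\frac{d}{dt}\big(\operatorname{leg}_L\circ\gamma^{(2k-1)}\big)(t)\right)\in\Sigma_L\qquad\text{for every } t\in I.$$ -/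

import Mathlib

open scoped Manifold ContDiff Topology

noncomputable section

namespace HigherOrder

/-!
Throughout, `Q` is a smooth manifold modelled on a real vector space `E`, and coordinates with an
index `1 ≤ i ≤ n` are written as vectors of `E` (for `q_(j)`) or covectors of `E` (for momenta and
for partial derivatives `∂L/∂q_(j)`).
-/

section Curves

variable (E : Type*) [NormedAddCommGroup E] [NormedSpace ℝ E]
  {Q : Type*} [TopologicalSpace Q] [ChartedSpace E Q]

/-- The curve `γ` is smooth on a neighbourhood of the time `t`. -/
def SmoothNear (γ : ℝ → Q) (t : ℝ) : Prop :=
  ∀ᶠ s in 𝓝 t, ContMDiffAt 𝓘(ℝ, ℝ) 𝓘(ℝ, E) ∞ γ s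

variable (Q) in
/-- Curves in `Q` that are smooth on some interval `(-a, a)`; the values outside of such an
interval play no role. -/
structure LocalCurve where
  /-- the underlying function -/
  toFun : ℝ → Q
  smooth : SmoothNear E toFun 0

variable {E}

/-- Contact of order `k` at time `0`, tested in some local chart. -/
def HaveContact (k : ℕ) (γ₁ γ₂ : LocalCurve E Q) : Prop :=
  γ₁.toFun 0 = γ₂.toFun 0 ∧ ∃ φ ∈ IsManifold.maximalAtlas 𝓘(ℝ, E) ∞ Q, γ₁.toFun 0 ∈ φ.source ∧
    ∀ j ≤ k, iteratedDeriv j (φ ∘ γ₁.toFun) 0 = iteratedDeriv j (φ ∘ γ₂.toFun) 0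

theorem SmoothNear.contDiffAt_chart {γ : ℝ → Q} {t : ℝ} (hγ : SmoothNear E γ t)
    {φ : OpenPartialHomeomorph Q E} (hφ : φ ∈ IsManifold.maximalAtlas 𝓘(ℝ, E) ∞ Q)
    (ht : γ t ∈ φ.source) : ContDiffAt ℝ ∞ (φ ∘ γ) t := by
  rw [← contMDiffAt_iff_contDiffAt]
  exact (contMDiffAt_of_mem_maximalAtlas hφ ht).comp t hγ.self_of_nhds

theorem contDiffAt_transition {φ ψ : OpenPartialHomeomorph Q E}
    (hφ : φ ∈ IsManifold.maximalAtlas 𝓘(ℝ, E) ∞ Q) (hψ : ψ ∈ IsManifold.maximalAtlas 𝓘(ℝ, E) ∞ Q)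
    {y : E} (hy : y ∈ φ.target) (hy' : φ.symm y ∈ ψ.source) :
    ContDiffAt ℝ ∞ (ψ ∘ φ.symm) y := by
  rw [← contMDiffAt_iff_contDiffAt]
  exact (contMDiffAt_of_mem_maximalAtlas hψ hy').comp y (contMDiffAt_symm_of_mem_maximalAtlas hφ hy)

/-- Change of chart for the derivatives of a curve. -/
theorem iteratedDeriv_chart_change {γ : ℝ → Q} {t : ℝ} (hγ : SmoothNear E γ t)
    {φ ψ : OpenPartialHomeomorph Q E}
    (hφ : φ ∈ IsManifold.maximalAtlas 𝓘(ℝ, E) ∞ Q) (hψ : ψ ∈ IsManifold.maximalAtlas 𝓘(ℝ, E) ∞ Q)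
    (h1 : γ t ∈ φ.source) (h2 : γ t ∈ ψ.source) (j : ℕ) :
    iteratedDeriv j (ψ ∘ γ) t = ∑ c : OrderedFinpartition j,
      iteratedFDeriv ℝ c.length (ψ ∘ φ.symm) (φ (γ t))
        fun i ↦ iteratedDeriv (c.partSize i) (φ ∘ γ) t := by
  have hc : ContinuousAt γ t := hγ.self_of_nhds.continuousAt
  have e : ψ ∘ γ =ᶠ[𝓝 t] (ψ ∘ φ.symm) ∘ (φ ∘ γ) := by
    filter_upwards [hc.preimage_mem_nhds (φ.open_source.mem_nhds h1)] with s hs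
    have hs' : γ s ∈ φ.source := hs
    simp [φ.left_inv hs']
  rw [e.iteratedDeriv_eq]
  refine iteratedDeriv_vcomp_eq_sum_orderedFinpartition (n := ∞)
    (contDiffAt_transition hφ hψ (φ.map_source h1) ?_) (hγ.contDiffAt_chart hφ h1) ?_
  · simpa [φ.left_inv h1] using h2
  · exact_mod_cast le_top

theorem HaveContact.chart {k : ℕ} {γ₁ γ₂ : LocalCurve E Q} (h : HaveContact k γ₁ γ₂)
    {ψ : OpenPartialHomeomorph Q E} (hψ : ψ ∈ IsManifold.maximalAtlas 𝓘(ℝ, E) ∞ Q)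
    (h0 : γ₁.toFun 0 ∈ ψ.source) {j : ℕ} (hj : j ≤ k) :
    iteratedDeriv j (ψ ∘ γ₁.toFun) 0 = iteratedDeriv j (ψ ∘ γ₂.toFun) 0 := by
  obtain ⟨h0', φ, hφ, hs, hd⟩ := h
  rw [iteratedDeriv_chart_change γ₁.smooth hφ hψ hs h0,
    iteratedDeriv_chart_change γ₂.smooth hφ hψ (h0' ▸ hs) (h0' ▸ h0), h0']
  refine Finset.sum_congr rfl fun c _ ↦ ?_
  congr 1
  ext i
  exact hd _ ((c.partSize_le i).trans hj)

theorem SmoothNear.comp_const_add {γ : ℝ → Q} {t : ℝ}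
    (hγ : SmoothNear E γ t) : SmoothNear E (fun s ↦ γ (t + s)) 0 := by
  have h : Filter.Tendsto (fun s : ℝ ↦ t + s) (𝓝 0) (𝓝 t) := by
    simpa using (continuous_const_add t).tendsto 0
  filter_upwards [h.eventually hγ] with s hs
  exact hs.comp s (contMDiffAt_iff_contDiffAt.2 (by fun_prop))

theorem smoothNear_symm_comp {φ : OpenPartialHomeomorph Q E}
    (hφ : φ ∈ IsManifold.maximalAtlas 𝓘(ℝ, E) ∞ Q) {c : ℝ → E} (hc : ContDiff ℝ ∞ c)
    (h : c 0 ∈ φ.target) : SmoothNear E (φ.symm ∘ c) 0 := by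
  filter_upwards [hc.continuous.continuousAt.preimage_mem_nhds (φ.open_target.mem_nhds h)] with s hs
  exact (contMDiffAt_symm_of_mem_maximalAtlas hφ hs).comp s hc.contMDiff.contMDiffAt

end Curves

section Generic

/-- The velocity `dc/dt` at time `t` of a curve in a manifold, as a point of the tangent bundle. -/
def velocity {F H : Type*} [NormedAddCommGroup F] [NormedSpace ℝ F] [TopologicalSpace H]
    (I : ModelWithCorners ℝ F H) {M : Type*} [TopologicalSpace M] [ChartedSpace H M]
    (c : ℝ → M) (t : ℝ) : TangentBundle I M :=
  ⟨c t, mfderiv 𝓘(ℝ, ℝ) I c t (1 : ℝ)⟩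

/-- The cotangent bundle `T^*M`, as the total space of Mathlib's bundle of continuous linear maps
from the tangent bundle to the trivial line bundle. -/
abbrev CotangentBundle {F H : Type*} [NormedAddCommGroup F] [NormedSpace ℝ F] [TopologicalSpace H]
    (I : ModelWithCorners ℝ F H) (M : Type*) [TopologicalSpace M] [ChartedSpace H M] : Type _ :=
  Bundle.TotalSpace (F →L[ℝ] ℝ) (fun x : M ↦ TangentSpace I x →L[ℝ] ℝ)

variable {F : Type*} [NormedAddCommGroup F] [NormedSpace ℝ F]
  {M : Type*} [TopologicalSpace M] [ChartedSpace F M] [IsManifold 𝓘(ℝ, F) 1 M]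

/-- The Tulczyjew isomorphism `α_M : T T^*M → T^* T M`. In the natural coordinates induced by a
chart of `M` it is `(q, p, qdot, pdot) ↦ (q, qdot, pdot, p)`, that is, the covector
`(δq, δv) ↦ pdot δq + p δv` at the point `(q, qdot)` of `TM`. Mathlib represents tangent vectors of
`M`, `TM` and `T^*M` at points over `x : M` by their components in the natural coordinates induced
by the preferred chart at `x`; the formula is written in those coordinates.
The lemma `tulczyjewAlpha_canonicalFlip` gives the chart-free characterization. -/
def tulczyjewAlpha
    (V : TangentBundle (𝓘(ℝ, F).prod 𝓘(ℝ, F →L[ℝ] ℝ)) (CotangentBundle 𝓘(ℝ, F) M)) :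
    CotangentBundle 𝓘(ℝ, F).tangent (TangentBundle 𝓘(ℝ, F) M) :=
  let p : F →L[ℝ] ℝ := V.1.2
  let qdot : F := V.2.1
  let pdot : F →L[ℝ] ℝ := V.2.2
  ⟨⟨V.1.1, qdot⟩, pdot.coprod p⟩

/-- The canonical flip `κ_M : T T M → T T M`, `(q, v, qdot, vdot) ↦ (q, qdot, v, vdot)`. -/
def canonicalFlip (W : TangentBundle 𝓘(ℝ, F).tangent (TangentBundle 𝓘(ℝ, F) M)) :
    TangentBundle 𝓘(ℝ, F).tangent (TangentBundle 𝓘(ℝ, F) M) :=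
  ⟨⟨W.1.1, W.2.1⟩, (W.1.2, W.2.2)⟩

/-- `tulczyjewAlpha` is the dual of the canonical flip: for curves `p` of covectors and `v` of
vectors over the same base curve `x`, `⟨α (dp/dt), κ (dv/dt)⟩ = d/dt ⟨p, v⟩`. -/
theorem tulczyjewAlpha_canonicalFlip {x : ℝ → M} {t : ℝ}
    {p : ∀ s, TangentSpace 𝓘(ℝ, F) (x s) →L[ℝ] ℝ} {v : ∀ s, TangentSpace 𝓘(ℝ, F) (x s)}
    (hp : MDifferentiableAt 𝓘(ℝ, ℝ) (𝓘(ℝ, F).prod 𝓘(ℝ, F →L[ℝ] ℝ))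
      (fun s ↦ (⟨x s, p s⟩ : CotangentBundle 𝓘(ℝ, F) M)) t)
    (hv : MDifferentiableAt 𝓘(ℝ, ℝ) 𝓘(ℝ, F).tangent
      (fun s ↦ (⟨x s, v s⟩ : TangentBundle 𝓘(ℝ, F) M)) t) :
    let A := tulczyjewAlpha
      (velocity _ (fun s ↦ (⟨x s, p s⟩ : CotangentBundle 𝓘(ℝ, F) M)) t)
    let W := canonicalFlip (velocity _ (fun s ↦ (⟨x s, v s⟩ : TangentBundle 𝓘(ℝ, F) M)) t)
    A.1 = W.1 ∧ HasDerivAt (fun s ↦ p s (v s)) ((A.2 : F × F →L[ℝ] ℝ) (W.2 : F × F)) t := by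
  intro A W
  have h1 := hp.hasMFDerivAt.2
  have h2 := hv.hasMFDerivAt.2
  have hx : ContinuousAt x t :=
    (FiberBundle.continuous_proj F (TangentSpace 𝓘(ℝ, F) (M := M))).continuousAt.comp
      hv.continuousAt
  let D1 : ℝ →L[ℝ] F × (F →L[ℝ] ℝ) := mfderiv 𝓘(ℝ, ℝ) (𝓘(ℝ, F).prod 𝓘(ℝ, F →L[ℝ] ℝ))
    (fun s ↦ (⟨x s, p s⟩ : CotangentBundle 𝓘(ℝ, F) M)) t
  let D2 : ℝ →L[ℝ] F × F := mfderiv 𝓘(ℝ, ℝ) 𝓘(ℝ, F).tangent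
    (fun s ↦ (⟨x s, v s⟩ : TangentBundle 𝓘(ℝ, F) M)) t
  let P : ℝ → F →L[ℝ] ℝ := fun s ↦
    ContinuousLinearMap.inCoordinates F (TangentSpace 𝓘(ℝ, F) (M := M)) ℝ (fun _ : M ↦ ℝ)
      (x t) (x s) (x t) (x s) (p s)
  let V : ℝ → F := fun s ↦ (trivializationAt F (TangentSpace 𝓘(ℝ, F) (M := M)) (x t) ⟨x s, v s⟩).2
  have d1 : HasFDerivAt (fun s ↦ (chartAt F (x t) (x s), P s)) D1 t := by
    rw [modelWithCornersSelf_coe, Set.range_id] at h1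
    refine HasFDerivAt.congr_of_eventuallyEq (hasFDerivWithinAt_univ.1 h1)
      (Filter.Eventually.of_forall fun s ↦ ?_)
    exact (hom_chart (F₁ := F) (F₂ := ℝ) (E₁ := TangentSpace 𝓘(ℝ, F) (M := M))
      (E₂ := fun _ : M ↦ ℝ) ⟨x t, p t⟩ ⟨x s, p s⟩).symm
  have d2 : HasFDerivAt (fun s ↦ (chartAt F (x t) (x s), V s)) D2 t := by
    rw [modelWithCornersSelf_coe, Set.range_id] at h2
    exact hasFDerivWithinAt_univ.1 h2
  have hb : ∀ s, x s ∈ (trivializationAt F (TangentSpace 𝓘(ℝ, F) (M := M)) (x t)).baseSet →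
      ∀ u : TangentSpace 𝓘(ℝ, F) (x s),
        P s (trivializationAt F (TangentSpace 𝓘(ℝ, F) (M := M)) (x t) ⟨x s, u⟩).2 = p s u := by
    intro s hs u
    have hP := ContinuousLinearMap.inCoordinates_eq (F := F) (E := TangentSpace 𝓘(ℝ, F) (M := M))
      (F' := ℝ) (E' := fun _ : M ↦ ℝ) (x₀ := x t) (y₀ := x t) (y := x s) (ϕ := p s) hs
      (Set.mem_univ _)
    have hP' : P s = _ := hP
    rw [hP']
    have h3 := ((trivializationAt F (TangentSpace 𝓘(ℝ, F) (M := M)) (x t)).continuousLinearEquivAt ℝ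
      (x s) hs).symm_apply_apply u
    exact congrArg (p s) h3
  have hbt := FiberBundle.mem_baseSet_trivializationAt' (F := F)
    (E := TangentSpace 𝓘(ℝ, F) (M := M)) (x t)
  have hT : ∀ u : TangentSpace 𝓘(ℝ, F) (x t),
      (trivializationAt F (TangentSpace 𝓘(ℝ, F) (M := M)) (x t) ⟨x t, u⟩).2 = u :=
    fun u ↦ (tangentBundleCore 𝓘(ℝ, F) M).coordChange_self (achart F (x t)) (x t)
      (mem_achart_source F (x t)) u
  have hVt : V t = v t := hT (v t)
  have hPt : ∀ u : F, P t u = p t u := fun u ↦ by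
    exact (congrArg (P t) (hT u)).symm.trans (hb t hbt u)
  have hev : (fun s ↦ p s (v s)) =ᶠ[𝓝 t] fun s ↦ P s (V s) := by
    filter_upwards [hx.preimage_mem_nhds
      ((trivializationAt F (TangentSpace 𝓘(ℝ, F) (M := M)) (x t)).open_baseSet.mem_nhds hbt)]
      with s hs
    exact (hb s hs (v s)).symm
  have ex : (D1 1).1 = (D2 1).1 := by
    exact congrArg (fun D : ℝ →L[ℝ] F ↦ D 1) (d1.fst.unique d2.fst)
  refine ⟨?_, ?_⟩
  · change (⟨x t, (D1 1).1⟩ : TangentBundle 𝓘(ℝ, F) M) = ⟨x t, (D2 1).1⟩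
    rw [ex]
  · have s1 : HasFDerivAt P ((ContinuousLinearMap.snd ℝ F (F →L[ℝ] ℝ)).comp D1) t := d1.snd
    have s2 : HasFDerivAt V ((ContinuousLinearMap.snd ℝ F F).comp D2) t := d2.snd
    have hd := ((s1.clm_apply s2).congr_of_eventuallyEq hev).hasDerivAt
    have he : P t (D2 1).2 + (D1 1).2 (V t) = (D1 1).2 (v t) + p t (D2 1).2 := by
      rw [hPt, hVt, add_comm]
    exact hd.congr_deriv he

end Generic

section Bundle

variable (E : Type*) [NormedAddCommGroup E] [NormedSpace ℝ E] (k : ℕ)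
  (Q : Type*) [TopologicalSpace Q] [ChartedSpace E Q] [IsManifold 𝓘(ℝ, E) ∞ Q]

/-- Contact of order `k` is an equivalence relation. -/
def contactSetoid : Setoid (LocalCurve E Q) where
  r := HaveContact k
  iseqv :=
    { refl := fun γ ↦ ⟨rfl, chartAt E (γ.toFun 0), IsManifold.chart_mem_maximalAtlas _,
        mem_chart_source _ _, fun _ _ ↦ rfl⟩
      symm := fun ⟨h, φ, hφ, hs, hd⟩ ↦ ⟨h.symm, φ, hφ, h ▸ hs, fun j hj ↦ (hd j hj).symm⟩
      trans := fun ⟨h, φ, hφ, hs, hd⟩ h' ↦ ⟨h.trans h'.1, φ, hφ, hs, fun j hj ↦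
        (hd j hj).trans (h'.chart hφ (h ▸ hs) hj)⟩ }

/-- The `k`-th order tangent bundle `T^(k) Q`: curves in `Q` modulo contact of order `k`. -/
def HOTangentBundle : Type _ := Quotient (contactSetoid E k Q)

namespace HOTangentBundle

variable {E k Q}

/-- The class `[γ]_0^(k)` of a curve. -/
def mk (γ : LocalCurve E Q) : HOTangentBundle E k Q := Quotient.mk (contactSetoid E k Q) γ

theorem mk_eq_mk {γ₁ γ₂ : LocalCurve E Q} :
    (mk γ₁ : HOTangentBundle E k Q) = mk γ₂ ↔ HaveContact k γ₁ γ₂ :=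
  Quotient.eq (r := contactSetoid E k Q)

/-- The projection `T^(k) Q → Q`, `[γ] ↦ γ 0`. -/
def base (x : HOTangentBundle E k Q) : Q :=
  Quotient.lift (s := contactSetoid E k Q) (fun γ ↦ γ.toFun 0) (fun _ _ h ↦ h.1) x

/-- The projection `T^(k) Q → T^(r) Q` for `r ≤ k`. -/
def proj {r : ℕ} (h : r ≤ k) (x : HOTangentBundle E k Q) : HOTangentBundle E r Q :=
  Quotient.lift (s := contactSetoid E k Q) (fun γ ↦ (mk γ : HOTangentBundle E r Q))
    (fun _ _ ⟨h0, φ, hφ, hs, hd⟩ ↦ mk_eq_mk.2 ⟨h0, φ, hφ, hs, fun j hj ↦ hd j (hj.trans h)⟩) x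

@[simp] theorem base_mk (γ : LocalCurve E Q) : base (mk γ : HOTangentBundle E k Q) = γ.toFun 0 := rfl

@[simp] theorem proj_mk {r : ℕ} (h : r ≤ k) (γ : LocalCurve E Q) :
    proj h (mk γ : HOTangentBundle E k Q) = mk γ := rfl

theorem exists_rep (x : HOTangentBundle E k Q) : ∃ γ : LocalCurve E Q, mk γ = x :=
  Quotient.exists_rep x

variable (E k) in
open scoped Classical in
/-- The class `[γ]_0^(k)` of a curve which is smooth near `0` (by convention the class of a constant
curve if `γ` is not smooth near `0`). -/
def jet (γ : ℝ → Q) : HOTangentBundle E k Q :=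
  if h : SmoothNear E γ 0 then mk ⟨γ, h⟩
  else mk ⟨fun _ ↦ γ 0, Filter.Eventually.of_forall fun _ ↦ contMDiffAt_const⟩

theorem jet_eq {γ : ℝ → Q} (h : SmoothNear E γ 0) :
    jet E k γ = mk ⟨γ, h⟩ := by
  simp [jet, h]

@[simp] theorem base_jet (γ : ℝ → Q) : base (jet E k γ) = γ 0 := by
  unfold jet; split_ifs <;> rfl

variable (E k) in
/-- The lift `γ^(k)(t) = [s ↦ γ (t + s)]_0^(k)` of a curve in `Q` to `T^(k) Q`. -/
def lift (γ : ℝ → Q) (t : ℝ) : HOTangentBundle E k Q :=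
  jet E k fun s ↦ γ (t + s)

/-- The natural coordinates `(q_(0), …, q_(k))` on `T^(k) Q` induced by a chart `φ` of `Q`:
the derivatives at `0`, up to order `k`, of the local expression of a representative. -/
def coord (φ : OpenPartialHomeomorph Q E) (x : HOTangentBundle E k Q) : Fin (k + 1) → E :=
  fun j ↦ iteratedDeriv j (φ ∘ (Quotient.out (s := contactSetoid E k Q) x).toFun) 0

theorem coord_mk {φ : OpenPartialHomeomorph Q E}
    (hφ : φ ∈ IsManifold.maximalAtlas 𝓘(ℝ, E) ∞ Q) {γ : LocalCurve E Q} (h : γ.toFun 0 ∈ φ.source)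
    (j : Fin (k + 1)) :
    coord φ (mk γ : HOTangentBundle E k Q) j = iteratedDeriv j (φ ∘ γ.toFun) 0 := by
  have hc : HaveContact k (Quotient.out (s := contactSetoid E k Q) (mk γ)) γ :=
    Quotient.mk_out (s := contactSetoid E k Q) γ
  exact hc.chart hφ (hc.1 ▸ h) (Nat.lt_succ_iff.1 j.2)

theorem coord_injective {φ : OpenPartialHomeomorph Q E}
    (hφ : φ ∈ IsManifold.maximalAtlas 𝓘(ℝ, E) ∞ Q) {x y : HOTangentBundle E k Q}
    (hx : base x ∈ φ.source) (hy : base y ∈ φ.source) (h : coord φ x = coord φ y) : x = y := by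
  obtain ⟨γ, rfl⟩ := exists_rep x
  obtain ⟨δ, rfl⟩ := exists_rep y
  have key (j : Fin (k + 1)) := congrFun h j
  simp only [coord_mk hφ hx, coord_mk hφ hy] at key
  refine mk_eq_mk.2 ⟨φ.injOn hx hy ?_, φ, hφ, hx, fun j hj ↦ key ⟨j, Nat.lt_succ_iff.2 hj⟩⟩
  simpa using key 0

/-- The polynomial curve with prescribed derivatives at `0`. -/
def polyCurve (y : Fin (k + 1) → E) (t : ℝ) : E :=
  ∑ i : Fin (k + 1), (t ^ (i : ℕ) / ((i : ℕ).factorial : ℝ)) • y i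

theorem contDiff_polyCurve (y : Fin (k + 1) → E) : ContDiff ℝ ∞ (polyCurve y) := by
  unfold polyCurve; fun_prop

theorem iteratedDeriv_polyCurve (y : Fin (k + 1) → E) (j : Fin (k + 1)) :
    iteratedDeriv j (polyCurve y) 0 = y j := by
  unfold polyCurve
  rw [iteratedDeriv_fun_sum (fun i _ ↦ by fun_prop), Finset.sum_eq_single j]
  · rw [iteratedDeriv_smul_const (by fun_prop), iteratedDeriv_div_const, iteratedDeriv_fun_pow_zero]
    simp [Nat.factorial_ne_zero]
  · intro i _ hij
    rw [iteratedDeriv_smul_const (by fun_prop), iteratedDeriv_div_const, iteratedDeriv_fun_pow_zero,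
      if_neg fun h ↦ hij (Fin.ext h.symm)]
    simp
  · simp

theorem polyCurve_zero (y : Fin (k + 1) → E) : polyCurve y 0 = y 0 := by
  simpa using iteratedDeriv_polyCurve y 0

theorem coord_jet_polyCurve {φ : OpenPartialHomeomorph Q E}
    (hφ : φ ∈ IsManifold.maximalAtlas 𝓘(ℝ, E) ∞ Q) {y : Fin (k + 1) → E} (hy : y 0 ∈ φ.target) :
    coord φ (jet E k (φ.symm ∘ polyCurve y)) = y := by
  have h0 : polyCurve y 0 ∈ φ.target := by rwa [polyCurve_zero]
  have hs := smoothNear_symm_comp hφ (contDiff_polyCurve y) h0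
  rw [jet_eq hs]
  ext j
  rw [coord_mk hφ (φ.map_target h0), ← iteratedDeriv_polyCurve y j]
  apply Filter.EventuallyEq.iteratedDeriv_eq
  filter_upwards [(contDiff_polyCurve y).continuous.continuousAt.preimage_mem_nhds
    (φ.open_target.mem_nhds h0)] with s hs
  exact φ.right_inv hs

/-- The natural chart of `T^(k) Q` induced by a chart `φ` of `Q`. -/
def natChart (φ : OpenPartialHomeomorph Q E)
    (hφ : φ ∈ IsManifold.maximalAtlas 𝓘(ℝ, E) ∞ Q) :
    PartialEquiv (HOTangentBundle E k Q) (Fin (k + 1) → E) where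
  toFun := coord φ
  invFun y := jet E k (φ.symm ∘ polyCurve y)
  source := {x | base x ∈ φ.source}
  target := {y | y 0 ∈ φ.target}
  map_source' x hx := by
    obtain ⟨γ, rfl⟩ := exists_rep x
    simp only [Set.mem_ofPred_eq, coord_mk hφ hx]
    simpa using φ.map_source hx
  map_target' y hy := by
    simpa [polyCurve_zero] using φ.map_target hy
  left_inv' x hx := by
    have ht : coord φ x 0 ∈ φ.target := by
      obtain ⟨γ, rfl⟩ := exists_rep x
      rw [coord_mk hφ hx]
      simpa using φ.map_source hx
    refine coord_injective hφ ?_ hx (coord_jet_polyCurve hφ ht)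
    simpa [polyCurve_zero] using φ.map_target ht
  right_inv' y hy := coord_jet_polyCurve hφ hy

theorem natChart_trans_source (φ ψ : OpenPartialHomeomorph Q E)
    (hφ : φ ∈ IsManifold.maximalAtlas 𝓘(ℝ, E) ∞ Q)
    (hψ : ψ ∈ IsManifold.maximalAtlas 𝓘(ℝ, E) ∞ Q) :
    ((natChart φ hφ (k := k)).symm.trans (natChart ψ hψ)).source =
      {y | y 0 ∈ (φ.symm.trans ψ).source} := by
  ext y
  simp [natChart, polyCurve_zero]

theorem contDiffOn_natChart_trans (φ ψ : OpenPartialHomeomorph Q E)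
    (hφ : φ ∈ IsManifold.maximalAtlas 𝓘(ℝ, E) ∞ Q)
    (hψ : ψ ∈ IsManifold.maximalAtlas 𝓘(ℝ, E) ∞ Q) :
    ContDiffOn ℝ ∞ ((natChart φ hφ (k := k)).symm.trans (natChart ψ hψ))
      ((natChart φ hφ (k := k)).symm.trans (natChart ψ hψ)).source := by
  rw [natChart_trans_source]
  rw [contDiffOn_pi]
  intro j
  have key : Set.EqOn
      (fun y ↦ ((natChart φ hφ (k := k)).symm.trans (natChart ψ hψ)) y j)
      (fun y ↦ ∑ c : OrderedFinpartition (j : ℕ),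
        iteratedFDeriv ℝ c.length (ψ ∘ φ.symm) (y 0)
          fun i ↦ y (Fin.ofNat (k + 1) (c.partSize i)))
      {y | y 0 ∈ (φ.symm.trans ψ).source} := by
    intro y hy
    have hy' : y 0 ∈ φ.target ∧ φ.symm (y 0) ∈ ψ.source := by simpa using hy
    have h0 : polyCurve y 0 ∈ φ.target := by rw [polyCurve_zero]; exact hy'.1
    have hs := smoothNear_symm_comp hφ (contDiff_polyCurve y) h0
    have hq : (φ.symm ∘ polyCurve y) 0 ∈ ψ.source := by
      simpa [polyCurve_zero] using hy'.2
    have hp : (φ.symm ∘ polyCurve y) 0 ∈ φ.source := φ.map_target h0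
    change coord ψ (jet E k (φ.symm ∘ polyCurve y)) j = _
    rw [jet_eq hs, coord_mk hψ hq, iteratedDeriv_chart_change hs hφ hψ hp hq]
    have e1 : φ ((φ.symm ∘ polyCurve y) 0) = y 0 := by
      simp [polyCurve_zero, φ.right_inv hy'.1]
    rw [e1]
    refine Finset.sum_congr rfl fun c _ ↦ ?_
    congr 1
    ext i
    have hlt : c.partSize i < k + 1 := ((c.partSize_le i)).trans_lt j.2
    have e2 := coord_jet_polyCurve hφ hy'.1
    rw [jet_eq hs] at e2
    have e3 := congrFun e2 (Fin.ofNat (k + 1) (c.partSize i))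
    rw [coord_mk hφ hp] at e3
    rw [← e3]
    simp [Nat.mod_eq_of_lt hlt]
  refine ContDiffOn.congr ?_ key
  intro y hy
  have hy' : y 0 ∈ φ.target ∧ φ.symm (y 0) ∈ ψ.source := by simpa using hy
  refine ContDiffAt.contDiffWithinAt (ContDiffAt.sum fun c _ ↦ ?_)
  have h1 : ContDiffAt ℝ ∞ (iteratedFDeriv ℝ c.length (ψ ∘ φ.symm)) (y 0) :=
    (contDiffAt_transition hφ hψ hy'.1 hy'.2).iteratedFDeriv_right (m := ∞) (by exact_mod_cast le_top)
  have h2 : ContDiffAt ℝ ∞ (fun y : Fin (k + 1) → E ↦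
      iteratedFDeriv ℝ c.length (ψ ∘ φ.symm) (y 0)) y :=
    h1.comp y (contDiff_apply ℝ E (0 : Fin (k + 1))).contDiffAt
  have h3 := (ContinuousLinearMap.cpolynomialAt_uncurry_of_multilinear
    (ContinuousLinearMap.id ℝ (ContinuousMultilinearMap ℝ (fun _ : Fin c.length ↦ E) E))
    (x := (iteratedFDeriv ℝ c.length (ψ ∘ φ.symm) (y 0),
      fun i ↦ y (Fin.ofNat (k + 1) (c.partSize i))))).contDiffAt (n := ∞)
  have h4 : ContDiffAt ℝ ∞ (fun y : Fin (k + 1) → E ↦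
      fun i : Fin c.length ↦ y (Fin.ofNat (k + 1) (c.partSize i))) y := by fun_prop
  exact h3.comp y (h2.prodMk h4)

/-- The manifold structure of `T^(k) Q`: its charts are the natural charts. -/
def chartedSpaceCore : ChartedSpaceCore (Fin (k + 1) → E) (HOTangentBundle E k Q) where
  atlas := {e | ∃ φ hφ, e = natChart φ hφ}
  chartAt x := natChart (chartAt E (base x)) (IsManifold.chart_mem_maximalAtlas _)
  mem_chart_source x := mem_chart_source E (base x)
  chart_mem_atlas x := ⟨_, _, rfl⟩
  open_source := by
    rintro _ _ ⟨φ, hφ, rfl⟩ ⟨ψ, hψ, rfl⟩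
    rw [natChart_trans_source]
    exact (φ.symm.trans ψ).open_source.preimage (continuous_apply 0)
  continuousOn_toFun := by
    rintro _ _ ⟨φ, hφ, rfl⟩ ⟨ψ, hψ, rfl⟩
    exact (contDiffOn_natChart_trans φ ψ hφ hψ).continuousOn

instance : TopologicalSpace (HOTangentBundle E k Q) := chartedSpaceCore.toTopologicalSpace

instance : ChartedSpace (Fin (k + 1) → E) (HOTangentBundle E k Q) :=
  chartedSpaceCore.toChartedSpace

/-- The natural chart of `T^(k) Q` induced by a chart of `Q`, as a chart of the manifold. -/
def chart (φ : OpenPartialHomeomorph Q E) (hφ : φ ∈ IsManifold.maximalAtlas 𝓘(ℝ, E) ∞ Q) :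
    OpenPartialHomeomorph (HOTangentBundle E k Q) (Fin (k + 1) → E) :=
  chartedSpaceCore.openPartialHomeomorph (natChart φ hφ) ⟨φ, hφ, rfl⟩

instance : IsManifold 𝓘(ℝ, Fin (k + 1) → E) ∞ (HOTangentBundle E k Q) := by
  refine isManifold_of_contDiffOn _ _ _ fun e e' he he' ↦ ?_
  obtain ⟨_, ⟨φ, hφ, rfl⟩, rfl⟩ : ∃ f, ∃ hf : f ∈ chartedSpaceCore.atlas,
      e = chartedSpaceCore.openPartialHomeomorph f hf := by
    have h := Set.mem_iUnion₂.1 (show e ∈ ⋃ (f) (hf : f ∈ chartedSpaceCore.atlas),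
      {chartedSpaceCore.openPartialHomeomorph f hf} from he)
    simpa using h
  obtain ⟨_, ⟨ψ, hψ, rfl⟩, rfl⟩ : ∃ f, ∃ hf : f ∈ chartedSpaceCore.atlas,
      e' = chartedSpaceCore.openPartialHomeomorph f hf := by
    have h := Set.mem_iUnion₂.1 (show e' ∈ ⋃ (f) (hf : f ∈ chartedSpaceCore.atlas),
      {chartedSpaceCore.openPartialHomeomorph f hf} from he')
    simpa using h
  simp only [modelWithCornersSelf_coe, modelWithCornersSelf_coe_symm, Function.id_comp,
    Function.comp_id, Set.preimage_id_eq, id, Set.range_id, Set.inter_univ]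
  exact contDiffOn_natChart_trans φ ψ hφ hψ


/-! ### Lifts of curves, the canonical immersion and the Tulczyjew derivation -/

theorem mem_chart_source_iff {φ : OpenPartialHomeomorph Q E}
    {hφ : φ ∈ IsManifold.maximalAtlas 𝓘(ℝ, E) ∞ Q} {x : HOTangentBundle E k Q} :
    x ∈ (chart φ hφ).source ↔ base x ∈ φ.source := Iff.rfl

theorem chartAt_eq (x : HOTangentBundle E k Q) :
    chartAt (Fin (k + 1) → E) x = chart (chartAt E (base x)) (IsManifold.chart_mem_maximalAtlas _) :=
  rfl

theorem coe_chart (φ : OpenPartialHomeomorph Q E)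
    (hφ : φ ∈ IsManifold.maximalAtlas 𝓘(ℝ, E) ∞ Q) :
    (chart φ hφ : HOTangentBundle E k Q → (Fin (k + 1) → E)) = coord φ := rfl

theorem base_lift (γ : ℝ → Q) (t : ℝ) : base (lift E k γ t) = γ t := by simp [lift]

theorem coord_lift {γ : ℝ → Q} {t : ℝ} (hγ : SmoothNear E γ t) {φ : OpenPartialHomeomorph Q E}
    (hφ : φ ∈ IsManifold.maximalAtlas 𝓘(ℝ, E) ∞ Q) (h : γ t ∈ φ.source) (j : Fin (k + 1)) :
    coord φ (lift E k γ t) j = iteratedDeriv j (φ ∘ γ) t := by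
  rw [lift, jet_eq hγ.comp_const_add, coord_mk hφ (by simpa using h)]
  have := congrFun (iteratedDeriv_comp_const_add (j : ℕ) (φ ∘ γ) t) 0
  simpa [Function.comp_def] using this

theorem eventually_coord_lift {γ : ℝ → Q} {t : ℝ} (hγ : SmoothNear E γ t)
    {φ : OpenPartialHomeomorph Q E}
    (hφ : φ ∈ IsManifold.maximalAtlas 𝓘(ℝ, E) ∞ Q) (h : γ t ∈ φ.source) :
    ∀ᶠ s in 𝓝 t, coord φ (lift E k γ s) = fun j : Fin (k + 1) ↦ iteratedDeriv j (φ ∘ γ) s := by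
  filter_upwards [eventually_eventually_nhds.2 hγ,
    hγ.self_of_nhds.continuousAt.preimage_mem_nhds (φ.open_source.mem_nhds h)] with s hs hs'
  ext j
  exact coord_lift hs hφ hs' j

theorem hasMFDerivAt_lift {γ : ℝ → Q} {t : ℝ} (hγ : SmoothNear E γ t) :
    HasMFDerivAt 𝓘(ℝ, ℝ) 𝓘(ℝ, Fin (k + 1) → E) (lift E k γ) t
      (ContinuousLinearMap.toSpanSingleton ℝ (fun j : Fin (k + 1) ↦
        iteratedDeriv (j + 1) (chartAt E (γ t) ∘ γ) t)) := by
  have hφ : chartAt E (γ t) ∈ IsManifold.maximalAtlas 𝓘(ℝ, E) ∞ Q :=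
    IsManifold.chart_mem_maximalAtlas _
  have hs : γ t ∈ (chartAt E (γ t)).source := mem_chart_source E _
  have hc := eventually_coord_lift (k := k) hγ hφ hs
  have hsm := hγ.contDiffAt_chart hφ hs
  have hd (j : ℕ) : HasDerivAt (iteratedDeriv j (chartAt E (γ t) ∘ γ))
      (iteratedDeriv (j + 1) (chartAt E (γ t) ∘ γ) t) t := by
    rw [iteratedDeriv_succ]
    have h1 : ContDiffAt ℝ ∞ (iteratedFDeriv ℝ j (chartAt E (γ t) ∘ γ)) t :=
      hsm.iteratedFDeriv_right (m := ∞) (by exact_mod_cast le_top)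
    have h2 : DifferentiableAt ℝ (iteratedDeriv j (chartAt E (γ t) ∘ γ)) t := by
      rw [iteratedDeriv_eq_equiv_comp]
      exact (LinearIsometryEquiv.differentiable _).differentiableAt.comp t
        (h1.differentiableAt (by simp))
    exact h2.hasDerivAt
  have hD : HasFDerivAt (fun s ↦ coord (k := k) (chartAt E (γ t)) (lift E k γ s))
      (ContinuousLinearMap.toSpanSingleton ℝ (fun j : Fin (k + 1) ↦
        iteratedDeriv (j + 1) (chartAt E (γ t) ∘ γ) t)) t := by
    refine HasFDerivAt.congr_of_eventuallyEq ?_ hc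
    exact (hasDerivAt_pi.2 fun j : Fin (k + 1) ↦ hd j).hasFDerivAt
  have hbase : base (lift E k γ t) = γ t := base_lift γ t
  have hsrc : ∀ᶠ s in 𝓝 t, lift E k γ s ∈ (chart (k := k) _ hφ).source := by
    filter_upwards [hγ.self_of_nhds.continuousAt.preimage_mem_nhds
      ((chartAt E (γ t)).open_source.mem_nhds hs)] with s hs'
    rw [mem_chart_source_iff, base_lift]
    exact hs'
  have hcont : ContinuousAt (lift E k γ) t := by
    have e : lift E k γ =ᶠ[𝓝 t]
        (chart (k := k) _ hφ).symm ∘ fun s ↦ coord (chartAt E (γ t)) (lift E k γ s) := by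
      filter_upwards [hsrc] with s hs'
      exact ((chart (k := k) _ hφ).left_inv hs').symm
    refine ContinuousAt.congr ?_ e.symm
    refine ContinuousAt.comp ?_ hD.continuousAt
    exact (chart (k := k) _ hφ).continuousAt_symm
      ((chart (k := k) _ hφ).map_source hsrc.self_of_nhds)
  refine ⟨hcont, ?_⟩
  have e : writtenInExtChartAt 𝓘(ℝ, ℝ) 𝓘(ℝ, Fin (k + 1) → E) t (lift E k γ) =
      fun s ↦ coord (k := k) (chartAt E (γ t)) (lift E k γ s) := by
    ext s
    simp only [writtenInExtChartAt, mfld_simps]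
    rw [chartAt_eq, coe_chart, hbase]
    rfl
  rw [e]
  exact hD.hasFDerivWithinAt


theorem velocity_lift_eq {γ₁ γ₂ : LocalCurve E Q} (h : HaveContact (k + 1) γ₁ γ₂) :
    velocity 𝓘(ℝ, Fin (k + 1) → E) (lift E k γ₁.toFun) 0 =
      velocity 𝓘(ℝ, Fin (k + 1) → E) (lift E k γ₂.toFun) 0 := by
  have key (x y : HOTangentBundle E k Q) (v w : Fin (k + 1) → E) (h1 : x = y) (h2 : v = w) :
      (⟨x, v⟩ : TangentBundle 𝓘(ℝ, Fin (k + 1) → E) (HOTangentBundle E k Q)) = ⟨y, w⟩ := by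
    subst h1 h2; rfl
  have hl (γ : LocalCurve E Q) : lift E k γ.toFun 0 = mk γ := by
    simp [lift, jet_eq γ.smooth]
  unfold velocity
  refine key _ _ _ _ ?_ ?_
  · rw [hl, hl, mk_eq_mk]
    exact ⟨h.1, chartAt E _, IsManifold.chart_mem_maximalAtlas _, mem_chart_source _ _,
      fun j hj ↦ h.chart (IsManifold.chart_mem_maximalAtlas _) (mem_chart_source _ _)
        (hj.trans k.le_succ)⟩
  · rw [(hasMFDerivAt_lift γ₁.smooth).mfderiv, (hasMFDerivAt_lift γ₂.smooth).mfderiv, ← h.1]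
    ext j
    have := h.chart (IsManifold.chart_mem_maximalAtlas (γ₁.toFun 0)) (mem_chart_source _ _)
      (show (j : ℕ) + 1 ≤ k + 1 by omega)
    exact congrArg ((1 : ℝ) • ·) this

/-- The canonical immersion `j_(k+1) : T^(k+1) Q → T (T^(k) Q)`, `[γ] ↦ dγ^(k)/dt (0)`. -/
def canonicalImmersion (x : HOTangentBundle E (k + 1) Q) :
    TangentBundle 𝓘(ℝ, Fin (k + 1) → E) (HOTangentBundle E k Q) :=
  Quotient.lift (s := contactSetoid E (k + 1) Q)
    (fun γ ↦ velocity 𝓘(ℝ, Fin (k + 1) → E) (lift E k γ.toFun) 0)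
    (fun _ _ h ↦ velocity_lift_eq h) x

/-- The Tulczyjew derivation on functions: `(d_T f)(x) = ⟨df, j_(k+1)(x)⟩`. -/
def tulczyjewD {F : Type*} [NormedAddCommGroup F] [NormedSpace ℝ F]
    (f : HOTangentBundle E k Q → F) (x : HOTangentBundle E (k + 1) Q) : F :=
  mfderiv 𝓘(ℝ, Fin (k + 1) → E) 𝓘(ℝ, F) f (canonicalImmersion x).1 (canonicalImmersion x).2

/-- The iterates `d_T^j`. -/
def tulczyjewDIter {F : Type*} [NormedAddCommGroup F] [NormedSpace ℝ F]
    (f : HOTangentBundle E k Q → F) : (j : ℕ) → HOTangentBundle E (k + j) Q → F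
  | 0 => f
  | j + 1 => tulczyjewD (tulczyjewDIter f j)

/-- The partial derivative `∂L/∂q_(r)` in the natural coordinates induced by the chart `φ`,
as a covector of the model space (only meaningful over the domain of `φ`). -/
def partialDeriv (φ : OpenPartialHomeomorph Q E) (hφ : φ ∈ IsManifold.maximalAtlas 𝓘(ℝ, E) ∞ Q)
    (L : HOTangentBundle E k Q → ℝ) (r : Fin (k + 1)) (x : HOTangentBundle E k Q) : E →L[ℝ] ℝ :=
  (fderiv ℝ (L ∘ (chart φ hφ).symm) (chart φ hφ x)).comp
    (ContinuousLinearMap.single ℝ (fun _ : Fin (k + 1) ↦ E) r)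

/-- The Jacobi–Ostrogradsky momentum with index `i`, `0 ≤ i ≤ k`, of a Lagrangian of order `k + 1`,
in the natural coordinates induced by `φ`:
`∑_{j=0}^{k-i} (-1)^j d_T^j (∂L/∂q_(i+1+j))`, each term being pulled back to `T^(2k+1) Q`
(only meaningful over the domain of `φ`). -/
def momentum (φ : OpenPartialHomeomorph Q E) (hφ : φ ∈ IsManifold.maximalAtlas 𝓘(ℝ, E) ∞ Q)
    (L : HOTangentBundle E (k + 1) Q → ℝ) (i : Fin (k + 1))
    (x : HOTangentBundle E (2 * k + 1) Q) : E →L[ℝ] ℝ :=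
  ∑ j : Fin (k - i + 1), (-1 : ℝ) ^ (j : ℕ) •
    tulczyjewDIter (partialDeriv φ hφ L ⟨i + 1 + j, by omega⟩) j (proj (by omega) x)

/-- The Poincaré–Cartan form `θ_L` on `T^(2k+1) Q` of a Lagrangian of order `k + 1`: in the natural
coordinates induced by a chart around the base point, `θ_L = ∑_{i=0}^{k} p_(i) dq_(i)` with the
Jacobi–Ostrogradsky momenta `p_(i)`. -/
def poincareCartan (L : HOTangentBundle E (k + 1) Q → ℝ) (x : HOTangentBundle E (2 * k + 1) Q) :
    TangentSpace 𝓘(ℝ, Fin (2 * k + 1 + 1) → E) x →L[ℝ] ℝ :=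
  ∑ i : Fin (k + 1), (momentum (chartAt E (base x)) (IsManifold.chart_mem_maximalAtlas _) L i x).comp
    (mfderiv 𝓘(ℝ, Fin (2 * k + 1 + 1) → E) 𝓘(ℝ, E)
      (fun y ↦ coord (chartAt E (base x)) y (i.castLE (by omega))) x)

/-- The Legendre–Ostrogradsky map `leg_L : T^(2k+1) Q → T^* T^(k) Q` over `T^(k) Q` of a Lagrangian
of order `k + 1`: `x ↦ ∑_i p_(i)(x) dq_(i)` at the projection of `x`. It is characterized by
`θ_L(u) = ⟨leg_L, Tτ u⟩`, see `poincareCartan_eq`. -/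
def legendreOstrogradsky (L : HOTangentBundle E (k + 1) Q → ℝ)
    (x : HOTangentBundle E (2 * k + 1) Q) :
    CotangentBundle 𝓘(ℝ, Fin (k + 1) → E) (HOTangentBundle E k Q) :=
  ⟨proj (by omega) x,
    ∑ i : Fin (k + 1), (momentum (chartAt E (base x)) (IsManifold.chart_mem_maximalAtlas _) L i x).comp
    (mfderiv 𝓘(ℝ, Fin (k + 1) → E) 𝓘(ℝ, E)
      (fun y ↦ coord (chartAt E (base x)) y i) (proj (by omega) x))⟩

theorem coord_proj {r : ℕ} (h : r ≤ k) {φ : OpenPartialHomeomorph Q E}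
    (hφ : φ ∈ IsManifold.maximalAtlas 𝓘(ℝ, E) ∞ Q) {x : HOTangentBundle E k Q}
    (hx : base x ∈ φ.source) (i : Fin (r + 1)) :
    coord φ (proj h x) i = coord φ x (i.castLE (by omega)) := by
  obtain ⟨γ, rfl⟩ := exists_rep x
  rw [proj_mk, coord_mk hφ hx, coord_mk hφ hx]
  rfl

theorem base_proj {r : ℕ} (h : r ≤ k) (x : HOTangentBundle E k Q) :
    base (proj h x) = base x := by
  obtain ⟨γ, rfl⟩ := exists_rep x
  rfl

theorem chart_mem_maximalAtlas (φ : OpenPartialHomeomorph Q E)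
    (hφ : φ ∈ IsManifold.maximalAtlas 𝓘(ℝ, E) ∞ Q) :
    (chart φ hφ : OpenPartialHomeomorph (HOTangentBundle E k Q) _) ∈
      IsManifold.maximalAtlas 𝓘(ℝ, Fin (k + 1) → E) ∞ (HOTangentBundle E k Q) := by
  refine IsManifold.subset_maximalAtlas ?_
  exact Set.mem_iUnion₂.2 ⟨natChart φ hφ, ⟨φ, hφ, rfl⟩, rfl⟩

theorem contMDiff_proj {r : ℕ} (h : r ≤ k) :
    ContMDiff 𝓘(ℝ, Fin (k + 1) → E) 𝓘(ℝ, Fin (r + 1) → E) ∞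
      (proj h : HOTangentBundle E k Q → HOTangentBundle E r Q) := by
  intro x
  have hφ : chartAt E (base x) ∈ IsManifold.maximalAtlas 𝓘(ℝ, E) ∞ Q :=
    IsManifold.chart_mem_maximalAtlas _
  have hx : x ∈ (chart (k := k) _ hφ).source := mem_chart_source E (base x)
  have hy : proj h x ∈ (chart (k := r) _ hφ).source := by
    rw [mem_chart_source_iff, base_proj]; exact hx
  let T : (Fin (k + 1) → E) → (Fin (r + 1) → E) := fun y i ↦ y (i.castLE (by omega))
  have hT : ContDiff ℝ ∞ T := by fun_prop
  have heq : ∀ z ∈ (chart (k := k) _ hφ).source,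
      chart (k := r) _ hφ (proj h z) = T (chart (k := k) _ hφ z) := by
    intro z hz
    ext i
    exact coord_proj h hφ hz i
  have e : proj h =ᶠ[𝓝 x] (chart (k := r) _ hφ).symm ∘ T ∘ (chart (k := k) _ hφ) := by
    filter_upwards [(chart (k := k) _ hφ).open_source.mem_nhds hx] with z hz
    simp only [Function.comp]
    rw [← heq z hz, OpenPartialHomeomorph.left_inv]
    rw [mem_chart_source_iff, base_proj]; exact hz
  refine ContMDiffAt.congr_of_eventuallyEq ?_ e
  refine ContMDiffAt.comp x (contMDiffAt_symm_of_mem_maximalAtlas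
    (chart_mem_maximalAtlas _ hφ) ?_) (hT.contMDiff.contMDiffAt.comp x
      (contMDiffAt_of_mem_maximalAtlas (chart_mem_maximalAtlas _ hφ) hx))
  simp only [Function.comp]
  rw [← heq x hx]
  exact (chart (k := r) _ hφ).map_source hy

/-- The defining relation `θ_L(u) = ⟨leg_L, Tτ^(k,2k+1) u⟩` of the Legendre–Ostrogradsky map. -/
theorem poincareCartan_eq (L : HOTangentBundle E (k + 1) Q → ℝ)
    (x : HOTangentBundle E (2 * k + 1) Q)
    (u : TangentSpace 𝓘(ℝ, Fin (2 * k + 1 + 1) → E) x) :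
    poincareCartan L x u = (legendreOstrogradsky L x).2
      (mfderiv 𝓘(ℝ, Fin (2 * k + 1 + 1) → E) 𝓘(ℝ, Fin (k + 1) → E)
        (proj (by omega : k ≤ 2 * k + 1)) x u) := by
  have hk : k ≤ 2 * k + 1 := by omega
  have hφ : chartAt E (base x) ∈ IsManifold.maximalAtlas 𝓘(ℝ, E) ∞ Q :=
    IsManifold.chart_mem_maximalAtlas _
  have hx : x ∈ (chart _ hφ).source := mem_chart_source E (base x)
  have hy : proj hk x ∈ (chart (k := k) _ hφ).source := by
    rw [mem_chart_source_iff, base_proj]; exact hx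
  have key (i : Fin (k + 1)) :
      mfderiv 𝓘(ℝ, Fin (2 * k + 1 + 1) → E) 𝓘(ℝ, E)
        (fun y ↦ coord (chartAt E (base x)) y (i.castLE (by omega))) x =
      (mfderiv 𝓘(ℝ, Fin (k + 1) → E) 𝓘(ℝ, E)
        (fun y : HOTangentBundle E k Q ↦ coord (chartAt E (base x)) y i) (proj hk x)).comp
      (mfderiv 𝓘(ℝ, Fin (2 * k + 1 + 1) → E) 𝓘(ℝ, Fin (k + 1) → E) (proj hk) x) := by
    rw [← mfderiv_comp_of_eq (x := x) (y := proj hk x) (I' := 𝓘(ℝ, Fin (k + 1) → E)) ?_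
      ((contMDiff_proj hk x).mdifferentiableAt (by simp)) rfl]
    · refine Filter.EventuallyEq.mfderiv_eq ?_
      filter_upwards [(chart _ hφ).open_source.mem_nhds hx] with z hz
      exact (coord_proj hk hφ hz i).symm
    · have h1 := contMDiffAt_of_mem_maximalAtlas (chart_mem_maximalAtlas (k := k) _ hφ) hy
      have h2 : ContMDiff 𝓘(ℝ, Fin (k + 1) → E) 𝓘(ℝ, E) ∞ (fun y : Fin (k + 1) → E ↦ y i) :=
        (contDiff_apply ℝ E i).contMDiff
      exact (h2.contMDiffAt.comp _ h1).mdifferentiableAt (by simp)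
  simp only [poincareCartan, legendreOstrogradsky]
  simp only [key]
  rw [sum_apply]
  have hsum (G : Fin (k + 1) → (Fin (k + 1) → E) →L[ℝ] ℝ) (w : Fin (k + 1) → E) :
      (∑ i, G i) w = ∑ i, G i w := sum_apply _ _ _
  exact (hsum
    (fun i ↦ (momentum (chartAt E (base x)) hφ L i x).comp
      (mfderiv 𝓘(ℝ, Fin (k + 1) → E) 𝓘(ℝ, E)
        (fun y : HOTangentBundle E k Q ↦ coord (chartAt E (base x)) y i) (proj hk x)))
    (mfderiv 𝓘(ℝ, Fin (2 * k + 1 + 1) → E) 𝓘(ℝ, Fin (k + 1) → E) (proj hk) x u)).symm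

/-- The submanifold `Σ_L = {μ ∈ T^* T T^(k) Q | j^* μ = dL}` of a Lagrangian of order `k + 1`, with
`j = j_(k+1)`: the covectors `ν` at points `j x` such that `ν ∘ T_x j = d_x L`. -/
def lagrangianSubmanifold (L : HOTangentBundle E (k + 1) Q → ℝ) :
    Set (CotangentBundle 𝓘(ℝ, Fin (k + 1) → E).tangent
      (TangentBundle 𝓘(ℝ, Fin (k + 1) → E) (HOTangentBundle E k Q))) :=
  {μ | ∃ (x : HOTangentBundle E (k + 1) Q)
    (ν : TangentSpace 𝓘(ℝ, Fin (k + 1) → E).tangent (canonicalImmersion x) →L[ℝ] ℝ),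
    μ = ⟨canonicalImmersion x, ν⟩ ∧
    ν.comp (mfderiv 𝓘(ℝ, Fin (k + 1 + 1) → E) 𝓘(ℝ, Fin (k + 1) → E).tangent canonicalImmersion x) =
      mfderiv 𝓘(ℝ, Fin (k + 1 + 1) → E) 𝓘(ℝ, ℝ) L x}

/-- The curve `γ` solves over `I` the Euler–Lagrange equations of the Lagrangian `L` of order `k`:
in all natural coordinates, `∑_{j=0}^{k} (-1)^j d^j/dt^j (∂L/∂q_(j) (γ^(k)(t))) = 0`. -/
def SolvesEulerLagrange (L : HOTangentBundle E k Q → ℝ) (γ : ℝ → Q) (I : Set ℝ) : Prop :=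
  ∀ (φ : OpenPartialHomeomorph Q E) (hφ : φ ∈ IsManifold.maximalAtlas 𝓘(ℝ, E) ∞ Q),
    ∀ t ∈ I, γ t ∈ φ.source →
      ∑ j : Fin (k + 1), (-1 : ℝ) ^ (j : ℕ) •
        iteratedDeriv j (fun s ↦ partialDeriv φ hφ L j (lift E k γ s)) t = 0

end HOTangentBundle
end Bundle
end HigherOrder

end

open HigherOrder HigherOrder.HOTangentBundle

/-! The index `k` of the code is one less than the order of the Lagrangian, so `L` has order `k +
1`. Fix a time t and a chart around γ(t). Along γ let B_m be ∂L/∂q_(m) evaluated on the lift of γ,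
and let S_m = ∑_j (-1)^j (d/dt)^j B_(m+j) (`ostrogradskySum`). Since d_T becomes d/dt along lifts of
curves, the momentum p_(i) is S_(i+1) (`momentum_lift`), and the Euler–Lagrange expression is S_0
(`sum_eulerLagrange`).

Differentiating term by term gives S_(m+1)' = B_m - S_m (`hasDerivAt_ostrogradskySum`). Hence the
Tulczyjew map sends the velocity of the Legendre curve to the covector (δq, δv) ↦ ∑ (B_i - S_i) δq_i
+ S_(i+1) δv_i, based at the velocity of the lift of γ, which is j of the next lift. In natural
coordinates j is the linear map pairing truncation with shift (`truncShift`), so the pullback by j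
is obtained by putting δq_i = w_i and δv_i = w_(i+1). The sum then telescopes to dL(w) - S_0(w_0)
(`telescope_ostrogradsky`). It equals dL for every w exactly when S_0 = 0
(`tulczyjewAlpha_mem_iff`).

What remains is independence of the chart. The Legendre map is written in the preferred chart at
each base point, and this chart varies along γ, whereas differentiation needs a fixed one; moreover
the Euler–Lagrange equations are required in all charts. Both points follow from one argument. For a
variation δ of γ, integration by parts expresses the derivative of ∑ p_(i) δ^(i) as dL applied to
the variation minus S_0 δ. The dL term is invariant, so the difference of the momentum pairings of
two charts (`momentumDefect`) has a derivative depending on δ only through its value at the given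
time. Cutting δ off on short intervals shows that such a local functional is zero
(`eq_zero_of_tensorial_deriv`). Thus ∑ p_(i) dq_(i) is invariant (`momentumForm_chart_change`), and
differentiating the vanishing defect shows that S_0 transforms as a covector
(`eulerLagrange_chart_change`). -/

noncomputable section

namespace HigherOrder

/-! ### Calculus in one variable: parameter derivatives, the cut-off argument, integration by parts.
-/

section Calculus

variable {E F : Type*} [NormedAddCommGroup E] [NormedSpace ℝ E]
  [NormedAddCommGroup F] [NormedSpace ℝ F]

theorem contDiffAt_iteratedDeriv {f : ℝ → F} {t : ℝ} (hf : ContDiffAt ℝ ∞ f t) (j : ℕ) :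
    ContDiffAt ℝ ∞ (iteratedDeriv j f) t := by
  rw [iteratedDeriv_eq_equiv_comp]
  exact (LinearIsometryEquiv.contDiff _).contDiffAt.comp t
    (hf.iteratedFDeriv_right (m := ∞) (by exact_mod_cast le_top))

theorem hasDerivAt_iteratedDeriv {f : ℝ → F} {t : ℝ} (hf : ContDiffAt ℝ ∞ f t) (j : ℕ) :
    HasDerivAt (iteratedDeriv j f) (iteratedDeriv (j + 1) f t) t := by
  rw [iteratedDeriv_succ]
  exact ((contDiffAt_iteratedDeriv hf j).differentiableAt (by simp)).hasDerivAt

/-- Commutation of a parameter derivative with the iterated derivatives in the other variable. -/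
theorem hasDerivAt_iteratedDeriv_param (j : ℕ) {H : ℝ × ℝ → F} {t : ℝ}
    (hH : ContDiffAt ℝ ∞ H (0, t)) :
    HasDerivAt (fun ε ↦ iteratedDeriv j (fun s ↦ H (ε, s)) t)
      (iteratedDeriv j (fun s ↦ fderiv ℝ H (0, s) (1, 0)) t) 0 := by
  induction j generalizing H with
  | zero =>
    simp only [iteratedDeriv_zero]
    have h1 : HasDerivAt (fun ε : ℝ ↦ (ε, t)) ((1 : ℝ), (0 : ℝ)) 0 :=
      (hasDerivAt_id 0).prodMk (hasDerivAt_const _ _)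
    exact (hH.differentiableAt (by simp)).hasFDerivAt.comp_hasDerivAt_of_eq 0 h1 rfl
  | succ j ih =>
    have h2 : ∀ᶠ p in 𝓝 ((0 : ℝ), t), ContDiffAt ℝ 2 H p :=
      (contDiffAt_infty.1 hH 2).eventually (by simp)
    have hs (ε s : ℝ) (h : ContDiffAt ℝ 2 H (ε, s)) :
        HasDerivAt (fun s ↦ H (ε, s)) (fderiv ℝ H (ε, s) (0, 1)) s := by
      have h1 : HasDerivAt (fun s : ℝ ↦ (ε, s)) ((0 : ℝ), (1 : ℝ)) s :=
        (hasDerivAt_const _ _).prodMk (hasDerivAt_id s)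
      exact (h.differentiableAt (by simp)).hasFDerivAt.comp_hasDerivAt s h1
    have hsm : ContDiffAt ℝ ∞ (fun p ↦ fderiv ℝ H p (0, 1)) (0, t) :=
      (hH.fderiv_right (m := ∞) (by exact_mod_cast le_top)).clm_apply contDiffAt_const
    have key := ih hsm
    -- One derivative in s is absorbed into the function, so the induction hypothesis applies to
    -- ∂H/∂s.
    have e1 : (fun ε ↦ iteratedDeriv (j + 1) (fun s ↦ H (ε, s)) t) =ᶠ[𝓝 0]
        fun ε ↦ iteratedDeriv j (fun s ↦ fderiv ℝ H (ε, s) (0, 1)) t := by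
      have h3 : ∀ᶠ ε in 𝓝 (0 : ℝ), ∀ᶠ p in 𝓝 (ε, t), ContDiffAt ℝ 2 H p :=
        (Continuous.prodMk_left t).continuousAt.eventually (eventually_eventually_nhds.2 h2)
      filter_upwards [h3] with ε hε
      rw [iteratedDeriv_succ']
      apply Filter.EventuallyEq.iteratedDeriv_eq
      filter_upwards [(Continuous.prodMk_right ε).continuousAt.eventually hε] with s h
      exact (hs ε s h).deriv
    -- Symmetry of the second derivative exchanges ∂/∂s and ∂/∂ε.
    have e2 : iteratedDeriv (j + 1) (fun s ↦ fderiv ℝ H (0, s) (1, 0)) t =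
        iteratedDeriv j (fun s ↦ fderiv ℝ (fun p ↦ fderiv ℝ H p (0, 1)) (0, s) (1, 0)) t := by
      rw [iteratedDeriv_succ']
      apply Filter.EventuallyEq.iteratedDeriv_eq
      filter_upwards [(Continuous.prodMk_right (0 : ℝ)).continuousAt.eventually h2] with s h
      have hd : DifferentiableAt ℝ (fderiv ℝ H) (0, s) :=
        (h.fderiv_right (m := 1) (by norm_num)).differentiableAt (by simp)
      have h1 : HasDerivAt (fun s : ℝ ↦ ((0 : ℝ), s)) ((0 : ℝ), (1 : ℝ)) s :=
        (hasDerivAt_const _ _).prodMk (hasDerivAt_id s)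
      have h4 := (hd.hasFDerivAt.comp_hasDerivAt s h1).clm_apply
        (hasDerivAt_const s ((1 : ℝ), (0 : ℝ)))
      have h5 := (hd.hasFDerivAt.clm_apply (hasFDerivAt_const ((0 : ℝ), (1 : ℝ)) ((0 : ℝ), s))).fderiv
      rw [show deriv (fun s ↦ fderiv ℝ H (0, s) (1, 0)) s = _ from h4.deriv, h5]
      have hsymm := (h.isSymmSndFDerivAt (by simp)) (0, 1) (1, 0)
      simpa using hsymm
    rw [e2]
    exact key.congr_of_eventuallyEq e1

/-- A local functional `D` of curves whose derivative is tensorial vanishes. -/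
theorem eq_zero_of_tensorial_deriv {D : (ℝ → E) → ℝ → ℝ} {z : ℝ → E →L[ℝ] ℝ} {t : ℝ}
    (hloc : ∀ δ₁ δ₂ : ℝ → E, ∀ s, δ₁ =ᶠ[𝓝 s] δ₂ → D δ₁ s = D δ₂ s)
    (hzero : ∀ s, D 0 s = 0) (hz : ContinuousAt z t)
    (hD : ∀ᶠ s in 𝓝 t, ∀ δ : ℝ → E, ContDiff ℝ ∞ δ → HasDerivAt (D δ) (z s (δ s)) s)
    {δ : ℝ → E} (hδ : ContDiff ℝ ∞ δ) : D δ t = 0 := by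
  have hc : ContinuousAt (fun s ↦ ‖z s (δ s)‖) t :=
    (hz.clm_apply hδ.continuous.continuousAt).norm
  obtain ⟨C, hC⟩ : ∃ C, ‖z t (δ t)‖ < C := exists_gt _
  have hev := hD.and (hc.eventually (gt_mem_nhds hC))
  obtain ⟨ρ, hρ, hball⟩ := Metric.eventually_nhds_iff.1 hev
  have hC0 : 0 < C := (norm_nonneg _).trans_lt hC
  have hbound : ∀ ε > 0, 3 * ε < ρ → ‖D δ t‖ ≤ C * (3 * ε) := by
    intro ε hε hερ
    -- The bump is 1 near t and 0 near t - 3ε. By locality, cutting δ off keeps the value of the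
    -- functional at t and makes it vanish at t - 3ε.
    let f : ContDiffBump t := ⟨ε, 2 * ε, hε, by linarith⟩
    have hfδ : ContDiff ℝ ∞ (fun s ↦ f s • δ s) := f.contDiff.smul hδ
    have h1 : D (fun s ↦ f s • δ s) t = D δ t := by
      refine hloc _ _ _ ?_
      filter_upwards [f.eventuallyEq_one] with s hs
      simp [hs]
    have h2 : D (fun s ↦ f s • δ s) (t - 3 * ε) = 0 := by
      rw [← hzero (t - 3 * ε)]
      refine hloc _ _ _ ?_
      have : t - 3 * ε ∈ (Metric.closedBall t (2 * ε))ᶜ := by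
        simp only [Set.mem_compl_iff, Metric.mem_closedBall, Real.dist_eq, not_le]
        rw [show t - 3 * ε - t = -(3 * ε) by ring, abs_neg, abs_of_pos (by linarith)]
        linarith
      filter_upwards [Metric.isClosed_closedBall.isOpen_compl.mem_nhds this] with s hs
      have : f s = 0 := by
        refine f.zero_of_le_dist ?_
        simp only [Set.mem_compl_iff, Metric.mem_closedBall, not_le] at hs
        exact hs.le
      simp [this]
    have hin : ∀ s ∈ Set.Icc (t - 3 * ε) t, dist s t < ρ := by
      intro s hs
      rw [Real.dist_eq, abs_sub_comm, abs_of_nonneg (by linarith [hs.2])]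
      linarith [hs.1]
    -- Here tensoriality matters: the derivative is z(fδ) = f z(δ), bounded by C uniformly in ε
    -- because 0 ≤ f ≤ 1. A derivative involving f' would grow like 1/ε.
    have h3 := Convex.norm_image_sub_le_of_norm_hasDerivWithin_le (𝕜 := ℝ)
      (f := D (fun s ↦ f s • δ s)) (f' := fun s ↦ z s (f s • δ s)) (C := C)
      (s := Set.Icc (t - 3 * ε) t) (x := t - 3 * ε) (y := t)
      (fun s hs ↦ ((hball (hin s hs)).1 _ hfδ).hasDerivWithinAt) (fun s hs ↦ by
        rw [map_smul, norm_smul, Real.norm_of_nonneg f.nonneg]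
        exact (mul_le_of_le_one_left (norm_nonneg _) f.le_one).trans (hball (hin s hs)).2.le)
      (convex_Icc _ _) (by simp [hε.le]) (by simp [hε.le])
    rw [h1, h2, sub_zero] at h3
    simpa [abs_of_pos hε] using h3
  by_contra hne
  have hpos : 0 < ‖D δ t‖ := norm_pos_iff.2 hne
  -- The first bound gives 3ε < ρ, the second makes the estimate C · 3ε at most half of the norm
  -- being estimated.
  have h4 := hbound (min (ρ / 6) (‖D δ t‖ / (6 * C))) (by positivity) (by
    have := min_le_left (ρ / 6) (‖D δ t‖ / (6 * C)); linarith)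
  have h5 : C * (3 * min (ρ / 6) (‖D δ t‖ / (6 * C))) ≤ C * (3 * (‖D δ t‖ / (6 * C))) := by
    gcongr; exact min_le_right _ _
  have h6 : C * (3 * (‖D δ t‖ / (6 * C))) = ‖D δ t‖ / 2 := by field_simp; norm_num
  linarith

/-- The alternating sums `∑_{j < n - m} (-1)^j B_(m+j)^(j)` of derivatives of a family of curves;
for `m = 0` this is the Euler–Lagrange expression, for `m ≥ 1` a Jacobi–Ostrogradsky momentum. -/
def ostrogradskySum (n : ℕ) (B : ℕ → ℝ → F) (m : ℕ) (s : ℝ) : F :=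
  ∑ j ∈ Finset.range (n - m), (-1 : ℝ) ^ j • iteratedDeriv j (B (m + j)) s

theorem ostrogradskySum_last (n : ℕ) (B : ℕ → ℝ → F) (s : ℝ) :
    ostrogradskySum (n + 1) B n s = B n s := by
  simp [ostrogradskySum]

theorem contDiffAt_ostrogradskySum {n : ℕ} {B : ℕ → ℝ → F} {s : ℝ}
    (hB : ∀ m, ContDiffAt ℝ ∞ (B m) s) (m : ℕ) : ContDiffAt ℝ ∞ (ostrogradskySum n B m) s :=
  ContDiffAt.sum fun j _ ↦ (contDiffAt_iteratedDeriv (hB _) j).const_smul _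

/-- Differentiating raises each order by one, so the j-th term becomes minus the (j+1)-st term of
the sum with index m. Only the zeroth term B m of that sum is not reached. The condition m < n
ensures that this term is present. -/
theorem hasDerivAt_ostrogradskySum {n : ℕ} {B : ℕ → ℝ → F} {s : ℝ}
    (hB : ∀ m, ContDiffAt ℝ ∞ (B m) s) {m : ℕ} (hm : m < n) :
    HasDerivAt (ostrogradskySum n B (m + 1)) (B m s - ostrogradskySum n B m s) s := by
  have h := HasDerivAt.fun_sum (u := Finset.range (n - (m + 1))) fun j _ ↦
    (hasDerivAt_iteratedDeriv (hB (m + 1 + j)) j).const_smul ((-1 : ℝ) ^ j)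
  refine h.congr_deriv ?_
  rw [ostrogradskySum, show n - m = n - (m + 1) + 1 by omega, Finset.sum_range_succ']
  simp only [pow_zero, iteratedDeriv_zero, one_smul, add_zero]
  rw [sub_add_eq_sub_sub_swap, sub_self, zero_sub, ← Finset.sum_neg_distrib]
  refine Finset.sum_congr rfl fun j _ ↦ ?_
  rw [pow_succ, mul_neg_one, neg_smul, neg_neg, show m + 1 + j = m + (j + 1) by ring]

/-- The algebra shared by integration by parts and by the pullback under the canonical immersion.
The upper boundary term S n (w n) supplies the missing top term of ∑ B i (w i), and only the lower
boundary term is left over. -/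
theorem telescope_ostrogradsky (n : ℕ) (B S : ℕ → E →L[ℝ] ℝ) (w : ℕ → E) (hS : S n = B n) :
    ∑ i ∈ Finset.range n, ((B i - S i) (w i) + S (i + 1) (w (i + 1))) =
      ∑ i ∈ Finset.range (n + 1), B i (w i) - S 0 (w 0) := by
  have h := Finset.sum_range_sub (fun i ↦ S i (w i)) n
  rw [Finset.sum_range_succ, ← hS]
  have : ∀ i ∈ Finset.range n, (B i - S i) (w i) + S (i + 1) (w (i + 1)) =
      B i (w i) + (S (i + 1) (w (i + 1)) - S i (w i)) := fun i _ ↦ by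
    rw [sub_apply]; ring
  rw [Finset.sum_congr rfl this, Finset.sum_add_distrib, h]
  ring

/-- Integration by parts for the Jacobi–Ostrogradsky momenta. -/
theorem hasDerivAt_sum_ostrogradskySum {n : ℕ} {B : ℕ → ℝ → E →L[ℝ] ℝ} {s : ℝ}
    (hB : ∀ m, ContDiffAt ℝ ∞ (B m) s) {δ : ℝ → E} (hδ : ContDiffAt ℝ ∞ δ s) :
    HasDerivAt (fun s ↦ ∑ i ∈ Finset.range n,
        ostrogradskySum (n + 1) B (i + 1) s (iteratedDeriv i δ s))
      (∑ i ∈ Finset.range (n + 1), B i s (iteratedDeriv i δ s) -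
        ostrogradskySum (n + 1) B 0 s (δ s)) s := by
  have h := HasDerivAt.fun_sum (u := Finset.range n) fun i hi ↦
    (hasDerivAt_ostrogradskySum (n := n + 1) hB (m := i) (by have := Finset.mem_range.1 hi; omega)).clm_apply
      (hasDerivAt_iteratedDeriv hδ i)
  refine h.congr_deriv ?_
  exact telescope_ostrogradsky n (fun i ↦ B i s) (fun i ↦ ostrogradskySum (n + 1) B i s)
    (fun i ↦ iteratedDeriv i δ s) (ostrogradskySum_last n B s)

end Calculus

/-! ### Charts of the base manifold along a curve. -/

section Charts

variable {E : Type*} [NormedAddCommGroup E] [NormedSpace ℝ E]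
  {Q : Type*} [TopologicalSpace Q] [ChartedSpace E Q]

theorem eventually_smoothNear_mem {γ : ℝ → Q} {t : ℝ} (hγ : SmoothNear E γ t)
    {φ : OpenPartialHomeomorph Q E} (h : γ t ∈ φ.source) :
    ∀ᶠ s in 𝓝 t, SmoothNear E γ s ∧ γ s ∈ φ.source :=
  (eventually_eventually_nhds.2 hγ).and
    (hγ.self_of_nhds.continuousAt.preimage_mem_nhds (φ.open_source.mem_nhds h))

theorem contDiffAt_transition_chart (hφ : φ ∈ IsManifold.maximalAtlas 𝓘(ℝ, E) ∞ Q)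
    (hψ : ψ ∈ IsManifold.maximalAtlas 𝓘(ℝ, E) ∞ Q) {γ : ℝ → Q} {t : ℝ}
    (h1 : γ t ∈ φ.source) (h2 : γ t ∈ ψ.source) :
    ContDiffAt ℝ ∞ (ψ ∘ φ.symm) (φ (γ t)) :=
  contDiffAt_transition hφ hψ (φ.map_source h1) (by rwa [φ.left_inv h1])

/-- The Jacobian of a change of charts of `Q` along a curve. -/
def jacobianAlong (φ ψ : OpenPartialHomeomorph Q E) (γ : ℝ → Q) (s : ℝ) : E →L[ℝ] E :=
  fderiv ℝ (ψ ∘ φ.symm) (φ (γ s))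

theorem contDiffAt_jacobianAlong (hφ : φ ∈ IsManifold.maximalAtlas 𝓘(ℝ, E) ∞ Q)
    (hψ : ψ ∈ IsManifold.maximalAtlas 𝓘(ℝ, E) ∞ Q) {γ : ℝ → Q} {t : ℝ} (hγ : SmoothNear E γ t)
    (h1 : γ t ∈ φ.source) (h2 : γ t ∈ ψ.source) : ContDiffAt ℝ ∞ (jacobianAlong φ ψ γ) t :=
  ContDiffAt.comp (g := fderiv ℝ (ψ ∘ φ.symm)) (f := φ ∘ γ) t
    ((contDiffAt_transition_chart hφ hψ h1 h2).fderiv_right (by exact_mod_cast le_top))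
    (hγ.contDiffAt_chart hφ h1)

end Charts

/-! ### Functions on higher-order tangent bundles along lifts of curves. -/

section Jets

variable {E : Type*} [NormedAddCommGroup E] [NormedSpace ℝ E] {k : ℕ}
  {Q : Type*} [TopologicalSpace Q] [ChartedSpace E Q] [IsManifold 𝓘(ℝ, E) ∞ Q]
  {F : Type*} [NormedAddCommGroup F] [NormedSpace ℝ F]

namespace HOTangentBundle

theorem proj_lift {r : ℕ} (h : r ≤ k) (γ : ℝ → Q) (t : ℝ) :
    proj h (lift E k γ t) = lift E r γ t := by
  unfold lift jet
  split_ifs <;> rfl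

/-- The base point is a separate variable because the base of a lift at t is only propositionally
equal to γ t; the same device recurs in later statements. -/
theorem chartAt_eq_of_base {x : HOTangentBundle E k Q} {q : Q} (h : base x = q) :
    chartAt (Fin (k + 1) → E) x = chart (chartAt E q) (IsManifold.chart_mem_maximalAtlas _) := by
  subst h; rfl

theorem lift_mem_source {γ : ℝ → Q} {t : ℝ} {φ : OpenPartialHomeomorph Q E}
    {hφ : φ ∈ IsManifold.maximalAtlas 𝓘(ℝ, E) ∞ Q} (h : γ t ∈ φ.source) :
    lift E k γ t ∈ (chart φ hφ).source := by
  rwa [mem_chart_source_iff, base_lift]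

theorem mem_chart_target_iff {φ : OpenPartialHomeomorph Q E}
    {hφ : φ ∈ IsManifold.maximalAtlas 𝓘(ℝ, E) ∞ Q} {y : Fin (k + 1) → E} :
    y ∈ (chart φ hφ).target ↔ y 0 ∈ φ.target := Iff.rfl

/-- Reduces pointwise claims on the bundle to claims along lifts of curves. -/
theorem exists_lift_eq (x : HOTangentBundle E k Q) :
    ∃ γ : ℝ → Q, SmoothNear E γ 0 ∧ x = lift E k γ 0 := by
  obtain ⟨γ, rfl⟩ := exists_rep x
  exact ⟨γ.toFun, γ.smooth, by simp [lift, jet_eq γ.smooth]⟩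

/-- Smoothness of the local expression of a function in a natural chart. -/
def SmoothOnChart (φ : OpenPartialHomeomorph Q E) (hφ : φ ∈ IsManifold.maximalAtlas 𝓘(ℝ, E) ∞ Q)
    (f : HOTangentBundle E k Q → F) : Prop :=
  ContDiffOn ℝ ∞ (f ∘ (chart φ hφ).symm) (chart φ hφ).target

variable {φ : OpenPartialHomeomorph Q E} {hφ : φ ∈ IsManifold.maximalAtlas 𝓘(ℝ, E) ∞ Q}

theorem SmoothOnChart.contDiffAt {f : HOTangentBundle E k Q → F} (hf : SmoothOnChart φ hφ f)
    {y : Fin (k + 1) → E} (hy : y ∈ (chart φ hφ).target) :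
    ContDiffAt ℝ ∞ (f ∘ (chart φ hφ).symm) y :=
  ContDiffOn.contDiffAt hf ((chart φ hφ).open_target.mem_nhds hy)

theorem smoothOnChart_of_contMDiff {f : HOTangentBundle E k Q → F}
    (hf : ContMDiff 𝓘(ℝ, Fin (k + 1) → E) 𝓘(ℝ, F) ∞ f) : SmoothOnChart φ hφ f := by
  intro y hy
  refine ContDiffAt.contDiffWithinAt (contMDiffAt_iff_contDiffAt.1 ?_)
  exact (hf _).comp y (contMDiffAt_symm_of_mem_maximalAtlas (chart_mem_maximalAtlas φ hφ) hy)

theorem SmoothOnChart.mdifferentiableAt {f : HOTangentBundle E k Q → F}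
    (hf : SmoothOnChart φ hφ f) {x : HOTangentBundle E k Q} (hx : base x ∈ φ.source) :
    MDifferentiableAt 𝓘(ℝ, Fin (k + 1) → E) 𝓘(ℝ, F) f x := by
  have hx' : x ∈ (chart φ hφ).source := hx
  have h1 := contMDiffAt_of_mem_maximalAtlas (chart_mem_maximalAtlas φ hφ) hx'
  have h2 := (hf.contDiffAt ((chart φ hφ).map_source hx')).contMDiffAt.comp x h1
  refine (h2.mdifferentiableAt (by simp)).congr_of_eventuallyEq ?_
  filter_upwards [(chart φ hφ).open_source.mem_nhds hx'] with z hz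
  simp [(chart φ hφ).left_inv hz]

theorem comp_lift_eventuallyEq {X : Type*} (f : HOTangentBundle E k Q → X)
    (hφ : φ ∈ IsManifold.maximalAtlas 𝓘(ℝ, E) ∞ Q) {γ : ℝ → Q} {t : ℝ}
    (hγ : SmoothNear E γ t) (ht : γ t ∈ φ.source) :
    (fun s ↦ f (lift E k γ s)) =ᶠ[𝓝 t]
      fun s ↦ (f ∘ (chart φ hφ).symm) fun j : Fin (k + 1) ↦ iteratedDeriv j (φ ∘ γ) s := by
  filter_upwards [eventually_coord_lift (k := k) hγ hφ ht, eventually_smoothNear_mem hγ ht]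
    with s hs hs'
  rw [← hs, Function.comp, ← coe_chart φ hφ, (chart φ hφ).left_inv (lift_mem_source hs'.2)]

theorem coords_mem_target (hφ : φ ∈ IsManifold.maximalAtlas 𝓘(ℝ, E) ∞ Q) {γ : ℝ → Q} {t : ℝ}
    (ht : γ t ∈ φ.source) :
    (fun j : Fin (k + 1) ↦ iteratedDeriv j (φ ∘ γ) t) ∈ (chart φ hφ).target := by
  rw [mem_chart_target_iff]
  simpa using φ.map_source ht

theorem SmoothOnChart.contDiffAt_comp_lift {f : HOTangentBundle E k Q → F}
    (hf : SmoothOnChart φ hφ f) {γ : ℝ → Q} {t : ℝ}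
    (hγ : SmoothNear E γ t) (ht : γ t ∈ φ.source) :
    ContDiffAt ℝ ∞ (fun s ↦ f (lift E k γ s)) t := by
  refine ContDiffAt.congr_of_eventuallyEq ?_ (comp_lift_eventuallyEq f hφ hγ ht)
  have h : ContDiffAt ℝ ∞ (fun s ↦ fun j : Fin (k + 1) ↦ iteratedDeriv j (φ ∘ γ) s) t :=
    contDiffAt_pi.2 fun j ↦ contDiffAt_iteratedDeriv (hγ.contDiffAt_chart hφ ht) _
  exact ContDiffAt.comp (g := f ∘ (chart φ hφ).symm) t
    (hf.contDiffAt (coords_mem_target hφ ht)) h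

theorem SmoothOnChart.hasDerivAt_comp_lift {f : HOTangentBundle E k Q → F}
    (hf : SmoothOnChart φ hφ f) {γ : ℝ → Q} {t : ℝ}
    (hγ : SmoothNear E γ t) (ht : γ t ∈ φ.source) :
    HasDerivAt (fun s ↦ f (lift E k γ s))
      (fderiv ℝ (f ∘ (chart φ hφ).symm) (fun j ↦ iteratedDeriv j (φ ∘ γ) t)
        (fun j ↦ iteratedDeriv (j + 1) (φ ∘ γ) t)) t := by
  refine HasDerivAt.congr_of_eventuallyEq ?_ (comp_lift_eventuallyEq f hφ hγ ht)
  have h : HasDerivAt (fun s ↦ fun j : Fin (k + 1) ↦ iteratedDeriv j (φ ∘ γ) s)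
      (fun j : Fin (k + 1) ↦ iteratedDeriv (j + 1) (φ ∘ γ) t) t :=
    hasDerivAt_pi.2 fun j ↦ hasDerivAt_iteratedDeriv (hγ.contDiffAt_chart hφ ht) _
  exact HasFDerivAt.comp_hasDerivAt (l := f ∘ (chart φ hφ).symm) t
    ((hf.contDiffAt (coords_mem_target hφ ht)).differentiableAt (by simp)).hasFDerivAt h

/-- The canonical immersion maps the lift of a curve to the velocity of its lift. -/
theorem canonicalImmersion_lift {γ : ℝ → Q} {t : ℝ} (hγ : SmoothNear E γ t) :
    canonicalImmersion (lift E (k + 1) γ t) = velocity 𝓘(ℝ, Fin (k + 1) → E) (lift E k γ) t := by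
  have e : lift E (k + 1) γ t = mk ⟨fun s ↦ γ (t + s), hγ.comp_const_add⟩ := jet_eq _
  have e2 : lift E k (fun s ↦ γ (t + s)) = fun s ↦ lift E k γ (t + s) := by
    ext s; simp [lift, add_assoc]
  rw [e]
  change velocity _ (lift E k (fun s ↦ γ (t + s))) 0 = _
  rw [e2]
  have key (x y : HOTangentBundle E k Q) (v w : Fin (k + 1) → E) (h1 : x = y) (h2 : v = w) :
      (⟨x, v⟩ : TangentBundle 𝓘(ℝ, Fin (k + 1) → E) (HOTangentBundle E k Q)) = ⟨y, w⟩ := by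
    subst h1 h2; rfl
  refine key _ _ _ _ (by simp) ?_
  have h1 : HasMFDerivAt 𝓘(ℝ, ℝ) 𝓘(ℝ, ℝ) (fun s : ℝ ↦ t + s) 0 (ContinuousLinearMap.id ℝ ℝ) :=
    ((hasFDerivAt_id (𝕜 := ℝ) (0 : ℝ)).const_add t).hasMFDerivAt
  have h2 : HasMFDerivAt 𝓘(ℝ, ℝ) 𝓘(ℝ, Fin (k + 1) → E) (lift E k γ) (t + 0)
      (ContinuousLinearMap.toSpanSingleton ℝ (fun j : Fin (k + 1) ↦
        iteratedDeriv (j + 1) (chartAt E (γ t) ∘ γ) t)) := by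
    rw [add_zero]; exact hasMFDerivAt_lift hγ
  have h3 := h2.comp 0 h1
  rw [(hasMFDerivAt_lift hγ).mfderiv]
  have h4 : mfderiv 𝓘(ℝ, ℝ) 𝓘(ℝ, Fin (k + 1) → E) (fun s ↦ lift E k γ (t + s)) 0 = _ := h3.mfderiv
  rw [h4]
  rfl

theorem tulczyjewD_lift {f : HOTangentBundle E k Q → F} {γ : ℝ → Q} {t : ℝ}
    (hγ : SmoothNear E γ t)
    (hf : MDifferentiableAt 𝓘(ℝ, Fin (k + 1) → E) 𝓘(ℝ, F) f (lift E k γ t)) :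
    tulczyjewD f (lift E (k + 1) γ t) = deriv (fun s ↦ f (lift E k γ s)) t := by
  rw [tulczyjewD, canonicalImmersion_lift hγ]
  have h := (hf.hasMFDerivAt.comp t (hasMFDerivAt_lift (k := k) hγ).mdifferentiableAt.hasMFDerivAt)
  have h' := h.mfderiv
  rw [mfderiv_eq_fderiv] at h'
  rw [← fderiv_apply_one_eq_deriv]
  exact (congrArg (fun A : ℝ →L[ℝ] F ↦ A 1) h').symm

/-- The coordinate formula d_T f = ∑ q_(j+1) ∂f/∂q_(j), read off by differentiating f along a curve
that represents the given jet. It shows that d_T preserves smoothness in a natural chart. -/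
theorem tulczyjewD_comp_chart_symm {f : HOTangentBundle E k Q → F}
    (hf : SmoothOnChart φ hφ f) {y : Fin (k + 1 + 1) → E} (hy : y 0 ∈ φ.target) :
    tulczyjewD f ((chart φ hφ).symm y) =
      fderiv ℝ (f ∘ (chart φ hφ).symm) (fun j : Fin (k + 1) ↦ y j.castSucc)
        (fun j : Fin (k + 1) ↦ y j.succ) := by
  have hs : base ((chart φ hφ).symm y) ∈ φ.source :=
    (chart φ hφ).map_target (show y ∈ (chart φ hφ).target from hy)
  have hc := (chart φ hφ).right_inv (show y ∈ (chart φ hφ).target from hy)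
  rw [coe_chart] at hc
  obtain ⟨γ, hγ, hx⟩ := exists_lift_eq ((chart φ hφ).symm y)
  rw [hx] at hc hs ⊢
  rw [base_lift] at hs
  rw [tulczyjewD_lift hγ (hf.mdifferentiableAt (by rwa [base_lift])),
    (hf.hasDerivAt_comp_lift hγ hs).deriv]
  have e (j : Fin (k + 1 + 1)) : iteratedDeriv j (φ ∘ γ) 0 = y j := by
    rw [← hc, coord_lift hγ hφ hs]
  congr 2
  · ext j; exact e j.castSucc
  · ext j; exact e j.succ

theorem SmoothOnChart.fderiv_contDiffOn {f : HOTangentBundle E k Q → F}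
    (hf : SmoothOnChart φ hφ f) :
    ContDiffOn ℝ ∞ (fderiv ℝ (f ∘ (chart φ hφ).symm)) (chart φ hφ).target :=
  ContDiffOn.fderiv_of_isOpen hf (chart φ hφ).open_target (by exact_mod_cast le_top)

theorem SmoothOnChart.tulczyjewD {f : HOTangentBundle E k Q → F}
    (hf : SmoothOnChart φ hφ f) : SmoothOnChart φ hφ (tulczyjewD f) := by
  have h : ContDiffOn ℝ ∞ (fun y : Fin (k + 1 + 1) → E ↦
      fderiv ℝ (f ∘ (chart φ hφ).symm) (fun j : Fin (k + 1) ↦ y j.castSucc)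
        (fun j : Fin (k + 1) ↦ y j.succ)) (chart φ hφ).target := by
    have h1 : ContDiff ℝ ∞ (fun (y : Fin (k + 1 + 1) → E) (j : Fin (k + 1)) ↦ y j.castSucc) := by
      fun_prop
    have h2 : ContDiff ℝ ∞ (fun (y : Fin (k + 1 + 1) → E) (j : Fin (k + 1)) ↦ y j.succ) := by
      fun_prop
    exact (hf.fderiv_contDiffOn.comp h1.contDiffOn fun y hy ↦ hy).clm_apply h2.contDiffOn
  exact h.congr fun y hy ↦ tulczyjewD_comp_chart_symm hf hy

theorem SmoothOnChart.tulczyjewDIter {f : HOTangentBundle E k Q → F}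
    (hf : SmoothOnChart φ hφ f) (j : ℕ) : SmoothOnChart φ hφ (tulczyjewDIter f j) := by
  induction j with
  | zero => exact hf
  | succ j ih => exact ih.tulczyjewD

/-- Iterates the chain rule `tulczyjewD_lift`. The time is generalized in the induction because the
inductive equality must hold near t before it can be differentiated. -/
theorem tulczyjewDIter_lift {f : HOTangentBundle E k Q → F} (hf : SmoothOnChart φ hφ f) (j : ℕ)
    {γ : ℝ → Q} {t : ℝ} (hγ : SmoothNear E γ t) (ht : γ t ∈ φ.source) :
    tulczyjewDIter f j (lift E (k + j) γ t) = iteratedDeriv j (fun s ↦ f (lift E k γ s)) t := by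
  induction j generalizing t with
  | zero => rfl
  | succ j ih =>
    rw [iteratedDeriv_succ]
    refine (tulczyjewD_lift hγ ((hf.tulczyjewDIter j).mdifferentiableAt
      (by rwa [base_lift]))).trans ?_
    apply Filter.EventuallyEq.deriv_eq
    filter_upwards [eventually_smoothNear_mem hγ ht] with s hs
    exact ih hs.1 hs.2

theorem smoothOnChart_partialDeriv {L : HOTangentBundle E k Q → ℝ}
    (hL : SmoothOnChart φ hφ L) (r : Fin (k + 1)) : SmoothOnChart φ hφ (partialDeriv φ hφ L r) := by
  have h : ContDiffOn ℝ ∞ (fun y ↦ (fderiv ℝ (L ∘ (chart φ hφ).symm) y).comp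
      (ContinuousLinearMap.single ℝ (fun _ : Fin (k + 1) ↦ E) r)) (chart φ hφ).target :=
    hL.fderiv_contDiffOn.clm_comp contDiffOn_const
  refine h.congr fun y hy ↦ ?_
  simp only [Function.comp, partialDeriv]
  rw [(chart φ hφ).right_inv hy]

/-- The partial derivatives `∂L/∂q_(m)` along the lift of a curve, extended by zero to all `m`. -/
def partialAlong (φ : OpenPartialHomeomorph Q E) (hφ : φ ∈ IsManifold.maximalAtlas 𝓘(ℝ, E) ∞ Q)
    (L : HOTangentBundle E k Q → ℝ) (γ : ℝ → Q) (m : ℕ) (s : ℝ) : E →L[ℝ] ℝ :=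
  if h : m < k + 1 then partialDeriv φ hφ L ⟨m, h⟩ (lift E k γ s) else 0

theorem contDiffAt_partialAlong {L : HOTangentBundle E k Q → ℝ} (hL : SmoothOnChart φ hφ L)
    {γ : ℝ → Q} {t : ℝ} (hγ : SmoothNear E γ t) (ht : γ t ∈ φ.source) (m : ℕ) :
    ContDiffAt ℝ ∞ (partialAlong φ hφ L γ m) t := by
  unfold partialAlong
  split_ifs
  · exact (smoothOnChart_partialDeriv hL _).contDiffAt_comp_lift hγ ht
  · exact contDiffAt_const

/-- Indexing by all natural numbers matches `telescope_ostrogradsky`; only the first k + 1 entries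
of w enter. -/
theorem sum_partialAlong (L : HOTangentBundle E k Q → ℝ)
    {γ : ℝ → Q} {t : ℝ} (hγ : SmoothNear E γ t) (ht : γ t ∈ φ.source) (w : ℕ → E) :
    ∑ m ∈ Finset.range (k + 1), partialAlong φ hφ L γ m t (w m) =
      fderiv ℝ (L ∘ (chart φ hφ).symm) (fun j : Fin (k + 1) ↦ iteratedDeriv j (φ ∘ γ) t)
        (fun j : Fin (k + 1) ↦ w j) := by
  rw [Finset.sum_range, ← ContinuousLinearMap.sum_comp_single _ (fun _ ↦ E)]
  refine Finset.sum_congr rfl fun j _ ↦ ?_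
  rw [partialAlong, dif_pos j.2, partialDeriv, coe_chart,
    (eventually_coord_lift (k := k) hγ hφ ht).self_of_nhds]

theorem sum_eulerLagrange (L : HOTangentBundle E k Q → ℝ) (γ : ℝ → Q) (t : ℝ) :
    ∑ j : Fin (k + 1), (-1 : ℝ) ^ (j : ℕ) •
        iteratedDeriv j (fun s ↦ partialDeriv φ hφ L j (lift E k γ s)) t =
      ostrogradskySum (k + 1) (partialAlong φ hφ L γ) 0 t := by
  rw [ostrogradskySum, Nat.sub_zero, Finset.sum_range]
  refine Finset.sum_congr rfl fun j _ ↦ ?_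
  congr 2
  ext s : 1
  simp [partialAlong, j.is_le]

theorem momentum_lift {L : HOTangentBundle E (k + 1) Q → ℝ} (hL : SmoothOnChart φ hφ L)
    {γ : ℝ → Q} {t : ℝ} (hγ : SmoothNear E γ t) (ht : γ t ∈ φ.source) (i : Fin (k + 1)) :
    momentum φ hφ L i (lift E (2 * k + 1) γ t) =
      ostrogradskySum (k + 1 + 1) (partialAlong φ hφ L γ) (i + 1) t := by
  rw [momentum, ostrogradskySum, show k + 1 + 1 - (i + 1) = k - i + 1 by omega, Finset.sum_range]
  refine Finset.sum_congr rfl fun j _ ↦ ?_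
  rw [proj_lift, tulczyjewDIter_lift (smoothOnChart_partialDeriv hL _) j hγ ht]
  congr 2
  ext s : 1
  have : (i : ℕ) + 1 + j < k + 1 + 1 := by omega
  simp [partialAlong, this]

end HOTangentBundle
end Jets

/-! ### Chart independence of the momenta and of the Euler–Lagrange expression. -/

section ChartChange

variable {E : Type*} [NormedAddCommGroup E] [NormedSpace ℝ E] {k : ℕ}
  {Q : Type*} [TopologicalSpace Q] [ChartedSpace E Q] [IsManifold 𝓘(ℝ, E) ∞ Q]

namespace HOTangentBundle

variable {φ ψ : OpenPartialHomeomorph Q E} {hφ : φ ∈ IsManifold.maximalAtlas 𝓘(ℝ, E) ∞ Q}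
  {hψ : ψ ∈ IsManifold.maximalAtlas 𝓘(ℝ, E) ∞ Q}

theorem exists_contDiff_iteratedDeriv_eq (w : Fin (k + 1) → E) (t : ℝ) :
    ∃ δ : ℝ → E, ContDiff ℝ ∞ δ ∧ ∀ j : Fin (k + 1), iteratedDeriv j δ t = w j := by
  refine ⟨fun s ↦ polyCurve w (s + -t),
    (contDiff_polyCurve w).comp (contDiff_id.add contDiff_const), fun j ↦ ?_⟩
  rw [iteratedDeriv_comp_add_const]
  simp [iteratedDeriv_polyCurve]

variable (k) in
theorem differentiableAt_transition (hφ : φ ∈ IsManifold.maximalAtlas 𝓘(ℝ, E) ∞ Q)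
    (hψ : ψ ∈ IsManifold.maximalAtlas 𝓘(ℝ, E) ∞ Q) {γ : ℝ → Q} {t : ℝ}
    (h1 : γ t ∈ φ.source) (h2 : γ t ∈ ψ.source) :
    DifferentiableAt ℝ (chart (k := k) ψ hψ ∘ (chart φ hφ).symm)
      (fun j ↦ iteratedDeriv j (φ ∘ γ) t) := by
  refine (contDiffAt_transition (chart_mem_maximalAtlas φ hφ) (chart_mem_maximalAtlas ψ hψ)
    (coords_mem_target hφ h1) ?_).differentiableAt (by simp)
  have h0 : (fun j : Fin (k + 1) ↦ iteratedDeriv j (φ ∘ γ) t) ∈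
      ((natChart φ hφ).symm.trans (natChart ψ hψ)).source := by
    rw [natChart_trans_source]
    simp [φ.map_source h1, φ.left_inv h1, h2]
  exact h0.2

variable (k) in
/-- The change of natural coordinates acts on variations of a curve through the Jacobian of the
change of charts. -/
theorem fderiv_transition_variation (hφ : φ ∈ IsManifold.maximalAtlas 𝓘(ℝ, E) ∞ Q)
    (hψ : ψ ∈ IsManifold.maximalAtlas 𝓘(ℝ, E) ∞ Q) {γ : ℝ → Q} {t : ℝ} (hγ : SmoothNear E γ t)
    (h1 : γ t ∈ φ.source) (h2 : γ t ∈ ψ.source) {δ : ℝ → E} (hδ : ContDiff ℝ ∞ δ) :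
    fderiv ℝ (chart (k := k) ψ hψ ∘ (chart φ hφ).symm) (fun j ↦ iteratedDeriv j (φ ∘ γ) t)
        (fun j ↦ iteratedDeriv j δ t) =
      fun j : Fin (k + 1) ↦ iteratedDeriv j (fun s ↦ jacobianAlong φ ψ γ s (δ s)) t := by
  let y : Fin (k + 1) → E := fun j ↦ iteratedDeriv j (φ ∘ γ) t
  let w : Fin (k + 1) → E := fun j ↦ iteratedDeriv j δ t
  -- The variation is affine in the chart φ. Its jets in the chart ψ are differentiated in ε twice
  -- over: by the chain rule through the change of natural coordinates, and by commuting ∂/∂ε with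
  -- the derivatives in s.
  let c : ℝ → ℝ → E := fun ε s ↦ φ (γ s) + ε • δ s
  let H : ℝ × ℝ → E := fun p ↦ (ψ ∘ φ.symm) (c p.1 p.2)
  have hc : ContDiffAt ℝ ∞ (φ ∘ γ) t := hγ.contDiffAt_chart hφ h1
  have hc2 (ε s : ℝ) (hs : ContDiffAt ℝ ∞ (φ ∘ γ) s) :
      ContDiffAt ℝ ∞ (fun p : ℝ × ℝ ↦ c p.1 p.2) (ε, s) :=
    (ContDiffAt.comp (g := φ ∘ γ) (ε, s) hs contDiffAt_snd).add
      (contDiffAt_fst.smul (hδ.contDiffAt.comp (ε, s) contDiffAt_snd))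
  have hH : ContDiffAt ℝ ∞ H (0, t) :=
    ContDiffAt.comp (g := ψ ∘ φ.symm) (f := fun p : ℝ × ℝ ↦ c p.1 p.2) (0, t)
      (by simpa [c] using contDiffAt_transition_chart hφ hψ h1 h2) (hc2 0 t hc)
  have hcurve : HasDerivAt (fun ε : ℝ ↦ y + ε • w) w 0 := by
    simpa using ((hasDerivAt_id (0 : ℝ)).smul_const w).const_add y
  have d1 : HasDerivAt (fun ε : ℝ ↦ (chart (k := k) ψ hψ ∘ (chart φ hφ).symm) (y + ε • w))
      (fderiv ℝ (chart (k := k) ψ hψ ∘ (chart φ hφ).symm) y w) 0 :=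
    (differentiableAt_transition k hφ hψ h1 h2).hasFDerivAt.comp_hasDerivAt_of_eq 0 hcurve
      (by simp [y])
  have d2 : HasDerivAt (fun ε ↦ fun j : Fin (k + 1) ↦ iteratedDeriv j (fun s ↦ H (ε, s)) t)
      (fun j : Fin (k + 1) ↦ iteratedDeriv j (fun s ↦ fderiv ℝ H (0, s) (1, 0)) t) 0 :=
    hasDerivAt_pi.2 fun j ↦ hasDerivAt_iteratedDeriv_param j hH
  have e2 : ∀ j : ℕ, iteratedDeriv j (fun s ↦ fderiv ℝ H (0, s) (1, 0)) t =
      iteratedDeriv j (fun s ↦ jacobianAlong φ ψ γ s (δ s)) t := by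
    intro j
    apply Filter.EventuallyEq.iteratedDeriv_eq
    filter_upwards [eventually_smoothNear_mem hγ h1, eventually_smoothNear_mem hγ h2] with s hs hs'
    have hd : HasFDerivAt (ψ ∘ φ.symm) (jacobianAlong φ ψ γ s) (c 0 s) := by
      have h := (contDiffAt_transition_chart hφ hψ hs.2 hs'.2).differentiableAt (by simp)
      rw [show c 0 s = φ (γ s) by simp [c]]
      exact h.hasFDerivAt
    have h3 := ((hc2 0 s (hs.1.contDiffAt_chart hφ hs.2)).differentiableAt (by simp)).hasFDerivAt
    have h4 : HasFDerivAt H _ (0, s) :=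
      HasFDerivAt.comp (g := ψ ∘ φ.symm) (f := fun p : ℝ × ℝ ↦ c p.1 p.2) (0, s) hd h3
    rw [h4.fderiv]
    have h5 : HasDerivAt (fun ε : ℝ ↦ (ε, s)) ((1 : ℝ), (0 : ℝ)) 0 :=
      (hasDerivAt_id 0).prodMk (hasDerivAt_const _ _)
    have h6 := h3.comp_hasDerivAt_of_eq 0 h5 rfl
    have h7 : HasDerivAt (fun ε ↦ c ε s) (δ s) 0 := by
      have h := ((hasDerivAt_id (0 : ℝ)).smul_const (δ s)).const_add (φ (γ s))
      rw [one_smul] at h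
      exact h
    exact congrArg (jacobianAlong φ ψ γ s) (h6.unique h7)
  -- For small ε the varied curve stays in both charts near t, and its jet at t has φ-coordinates y
  -- + ε w.
  have hev : (fun ε : ℝ ↦ (chart (k := k) ψ hψ ∘ (chart φ hφ).symm) (y + ε • w)) =ᶠ[𝓝 0]
      fun ε ↦ fun j : Fin (k + 1) ↦ iteratedDeriv j (fun s ↦ H (ε, s)) t := by
    have hcont : ContinuousAt (fun ε ↦ c ε t) 0 := by fun_prop
    have hO : (φ.symm.trans ψ).source ∈ 𝓝 (c 0 t) :=
      (φ.symm.trans ψ).open_source.mem_nhds (by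
        simp [c, φ.map_source h1, φ.left_inv h1, h2])
    filter_upwards [hcont.preimage_mem_nhds hO] with ε hε
    have hε' : c ε t ∈ φ.target ∧ φ.symm (c ε t) ∈ ψ.source := by simpa using hε
    let γε : ℝ → Q := fun s ↦ φ.symm (c ε s)
    have hsm : SmoothNear E γε t := by
      have hct : ContinuousAt (c ε) t :=
        hc.continuousAt.add (continuousAt_const.smul hδ.continuous.continuousAt)
      filter_upwards [eventually_smoothNear_mem hγ h1,
        hct.preimage_mem_nhds (φ.open_target.mem_nhds hε'.1)] with s hs hs'
      refine (contMDiffAt_symm_of_mem_maximalAtlas hφ hs').comp s ?_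
      exact contMDiffAt_iff_contDiffAt.2
        ((hs.1.contDiffAt_chart hφ hs.2).add (contDiffAt_const.smul hδ.contDiffAt))
    have hsrc : γε t ∈ φ.source := φ.map_target hε'.1
    have hcε : φ ∘ γε =ᶠ[𝓝 t] fun s ↦ (φ ∘ γ) s + ε • δ s := by
      have hct : ContinuousAt (c ε) t :=
        hc.continuousAt.add (continuousAt_const.smul hδ.continuous.continuousAt)
      filter_upwards [hct.preimage_mem_nhds (φ.open_target.mem_nhds hε'.1)] with s hs'
      exact φ.right_inv hs'
    have hcoord : chart (k := k) φ hφ (lift E k γε t) = y + ε • w := by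
      ext j
      have hδε : ContDiffAt ℝ ∞ (fun s ↦ ε • δ s) t := contDiffAt_const.smul hδ.contDiffAt
      rw [coe_chart, coord_lift hsm hφ hsrc, hcε.iteratedDeriv_eq,
        iteratedDeriv_fun_add (contDiffAt_infty.1 hc _) (contDiffAt_infty.1 hδε _),
        iteratedDeriv_fun_const_smul_field]
      rfl
    rw [Function.comp, ← hcoord, (chart φ hφ).left_inv (lift_mem_source hsrc)]
    ext j
    rw [coe_chart, coord_lift hsm hψ hε'.2]
    rfl
  have := d1.unique (d2.congr_of_eventuallyEq hev)
  rw [show fderiv ℝ (chart (k := k) ψ hψ ∘ (chart φ hφ).symm)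
    (fun j ↦ iteratedDeriv j (φ ∘ γ) t) (fun j ↦ iteratedDeriv j δ t) = _ from this]
  ext j
  exact e2 j

variable (k) in
theorem coords_transition (hφ : φ ∈ IsManifold.maximalAtlas 𝓘(ℝ, E) ∞ Q)
    (hψ : ψ ∈ IsManifold.maximalAtlas 𝓘(ℝ, E) ∞ Q) {γ : ℝ → Q} {t : ℝ} (hγ : SmoothNear E γ t)
    (h1 : γ t ∈ φ.source) (h2 : γ t ∈ ψ.source) :
    (chart (k := k) ψ hψ ∘ (chart φ hφ).symm) (fun j ↦ iteratedDeriv j (φ ∘ γ) t) =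
      fun j : Fin (k + 1) ↦ iteratedDeriv j (ψ ∘ γ) t := by
  rw [← (eventually_coord_lift (k := k) hγ hφ h1).self_of_nhds, Function.comp, ← coe_chart φ hφ,
    (chart φ hφ).left_inv (lift_mem_source h1), coe_chart]
  exact (eventually_coord_lift (k := k) hγ hψ h2).self_of_nhds

/-- The differential of `L` along a variation of a curve does not depend on the chart. -/
theorem sum_partialAlong_variation {L : HOTangentBundle E k Q → ℝ} (hL : SmoothOnChart ψ hψ L)
    (hφ : φ ∈ IsManifold.maximalAtlas 𝓘(ℝ, E) ∞ Q) {γ : ℝ → Q} {t : ℝ} (hγ : SmoothNear E γ t)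
    (h1 : γ t ∈ φ.source) (h2 : γ t ∈ ψ.source) {δ : ℝ → E} (hδ : ContDiff ℝ ∞ δ) :
    ∑ m ∈ Finset.range (k + 1), partialAlong φ hφ L γ m t (iteratedDeriv m δ t) =
      ∑ m ∈ Finset.range (k + 1), partialAlong ψ hψ L γ m t
        (iteratedDeriv m (fun s ↦ jacobianAlong φ ψ γ s (δ s)) t) := by
  rw [sum_partialAlong L hγ h1, sum_partialAlong L hγ h2,
    ← fderiv_transition_variation k hφ hψ hγ h1 h2 hδ, ← coords_transition k hφ hψ hγ h1 h2,
    ← ContinuousLinearMap.comp_apply, ← fderiv_comp]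
  · congr 1
    apply Filter.EventuallyEq.fderiv_eq
    have hO : ((chart (k := k) φ hφ).symm.trans (chart ψ hψ)).source ∈
        𝓝 (fun j : Fin (k + 1) ↦ iteratedDeriv j (φ ∘ γ) t) := by
      refine ((chart (k := k) φ hφ).symm.trans (chart ψ hψ)).open_source.mem_nhds ?_
      refine ⟨coords_mem_target hφ h1, ?_⟩
      have := lift_mem_source (k := k) (hφ := hψ) h2
      rwa [← (chart φ hφ).left_inv (lift_mem_source (k := k) h1), coe_chart,
        (eventually_coord_lift (k := k) hγ hφ h1).self_of_nhds] at this
    filter_upwards [hO] with y hy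
    exact congrArg L ((chart ψ hψ).left_inv hy.2).symm
  · rw [coords_transition k hφ hψ hγ h1 h2]
    exact (hL.contDiffAt (coords_mem_target hψ h2)).differentiableAt (by simp)
  · exact differentiableAt_transition k hφ hψ h1 h2

/-- The difference of the pairings of a variation with the Jacobi–Ostrogradsky momenta of two
charts. -/
def momentumDefect (φ ψ : OpenPartialHomeomorph Q E)
    (hφ : φ ∈ IsManifold.maximalAtlas 𝓘(ℝ, E) ∞ Q) (hψ : ψ ∈ IsManifold.maximalAtlas 𝓘(ℝ, E) ∞ Q)
    (L : HOTangentBundle E (k + 1) Q → ℝ) (γ : ℝ → Q) (δ : ℝ → E) (s : ℝ) : ℝ :=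
  ∑ i ∈ Finset.range (k + 1), ostrogradskySum (k + 1 + 1) (partialAlong φ hφ L γ) (i + 1) s
      (iteratedDeriv i δ s) -
    ∑ i ∈ Finset.range (k + 1), ostrogradskySum (k + 1 + 1) (partialAlong ψ hψ L γ) (i + 1) s
      (iteratedDeriv i (fun s ↦ jacobianAlong φ ψ γ s (δ s)) s)

/-- Integration by parts in both charts; the two dL terms agree by `sum_partialAlong_variation` and
cancel, so no derivative of δ survives. -/
theorem hasDerivAt_momentumDefect {L : HOTangentBundle E (k + 1) Q → ℝ}
    (hLφ : SmoothOnChart φ hφ L) (hLψ : SmoothOnChart ψ hψ L)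
    {γ : ℝ → Q} {t : ℝ} (hγ : SmoothNear E γ t) (h1 : γ t ∈ φ.source) (h2 : γ t ∈ ψ.source)
    {δ : ℝ → E} (hδ : ContDiff ℝ ∞ δ) :
    HasDerivAt (momentumDefect φ ψ hφ hψ L γ δ)
      (((ostrogradskySum (k + 1 + 1) (partialAlong ψ hψ L γ) 0 t).comp (jacobianAlong φ ψ γ t) -
        ostrogradskySum (k + 1 + 1) (partialAlong φ hφ L γ) 0 t) (δ t)) t := by
  have d1 := hasDerivAt_sum_ostrogradskySum (n := k + 1)
    (contDiffAt_partialAlong hLφ hγ h1) hδ.contDiffAt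
  have d2 := hasDerivAt_sum_ostrogradskySum (n := k + 1)
    (contDiffAt_partialAlong hLψ hγ h2)
    ((contDiffAt_jacobianAlong hφ hψ hγ h1 h2).clm_apply hδ.contDiffAt)
  refine (d1.sub d2).congr_deriv ?_
  rw [sum_partialAlong_variation hLψ hφ hγ h1 h2 hδ, sub_apply,
    ContinuousLinearMap.comp_apply]
  ring

theorem momentumDefect_eq_zero {L : HOTangentBundle E (k + 1) Q → ℝ}
    (hLφ : SmoothOnChart φ hφ L) (hLψ : SmoothOnChart ψ hψ L)
    {γ : ℝ → Q} {t : ℝ} (hγ : SmoothNear E γ t) (h1 : γ t ∈ φ.source) (h2 : γ t ∈ ψ.source)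
    {δ : ℝ → E} (hδ : ContDiff ℝ ∞ δ) : momentumDefect φ ψ hφ hψ L γ δ t = 0 := by
  refine eq_zero_of_tensorial_deriv (D := momentumDefect φ ψ hφ hψ L γ) (z := fun s ↦
    (ostrogradskySum (k + 1 + 1) (partialAlong ψ hψ L γ) 0 s).comp (jacobianAlong φ ψ γ s) -
      ostrogradskySum (k + 1 + 1) (partialAlong φ hφ L γ) 0 s) ?_ ?_ ?_ ?_ hδ
  · intro δ₁ δ₂ s h
    have h' : (fun s ↦ jacobianAlong φ ψ γ s (δ₁ s)) =ᶠ[𝓝 s]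
        fun s ↦ jacobianAlong φ ψ γ s (δ₂ s) := h.mono fun s hs ↦ by simp [hs]
    simp only [momentumDefect, h.iteratedDeriv_eq, h'.iteratedDeriv_eq]
  · intro s
    simp [momentumDefect, Pi.zero_def]
  · exact (((contDiffAt_ostrogradskySum (contDiffAt_partialAlong hLψ hγ h2) 0).clm_comp
      (contDiffAt_jacobianAlong hφ hψ hγ h1 h2)).sub
      (contDiffAt_ostrogradskySum (contDiffAt_partialAlong hLφ hγ h1) 0)).continuousAt
  · filter_upwards [eventually_smoothNear_mem hγ h1, eventually_smoothNear_mem hγ h2]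
      with s hs hs' δ hδ
    exact hasDerivAt_momentumDefect hLφ hLψ hs.1 hs.2 hs'.2 hδ

/-- The Euler–Lagrange expression is a covector along the curve. -/
theorem eulerLagrange_chart_change {L : HOTangentBundle E (k + 1) Q → ℝ}
    (hLφ : SmoothOnChart φ hφ L) (hLψ : SmoothOnChart ψ hψ L)
    {γ : ℝ → Q} {t : ℝ} (hγ : SmoothNear E γ t) (h1 : γ t ∈ φ.source) (h2 : γ t ∈ ψ.source) :
    ostrogradskySum (k + 1 + 1) (partialAlong φ hφ L γ) 0 t =
      (ostrogradskySum (k + 1 + 1) (partialAlong ψ hψ L γ) 0 t).comp (jacobianAlong φ ψ γ t) := by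
  ext w
  have hw : ContDiff ℝ ∞ (fun _ : ℝ ↦ w) := contDiff_const
  -- The defect vanishes on a neighbourhood of t, hence so does its derivative at t, which is the
  -- difference of the two covectors evaluated at w.
  have h0 : momentumDefect φ ψ hφ hψ L γ (fun _ ↦ w) =ᶠ[𝓝 t] fun _ ↦ 0 := by
    filter_upwards [eventually_smoothNear_mem hγ h1, eventually_smoothNear_mem hγ h2]
      with s hs hs'
    exact momentumDefect_eq_zero hLφ hLψ hs.1 hs.2 hs'.2 hw
  have h := ((hasDerivAt_momentumDefect hLφ hLψ hγ h1 h2 hw).congr_of_eventuallyEq h0.symm).unique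
    (hasDerivAt_const t 0)
  rw [sub_apply, sub_eq_zero] at h
  exact h.symm

/-- The covector `∑ p_(i) dq_(i)` in the natural coordinates of a chart, along the lift of a
curve. -/
def momentumForm (φ : OpenPartialHomeomorph Q E) (hφ : φ ∈ IsManifold.maximalAtlas 𝓘(ℝ, E) ∞ Q)
    (L : HOTangentBundle E (k + 1) Q → ℝ) (γ : ℝ → Q) (s : ℝ) : (Fin (k + 1) → E) →L[ℝ] ℝ :=
  ∑ i : Fin (k + 1), (ostrogradskySum (k + 1 + 1) (partialAlong φ hφ L γ) (i + 1) s).comp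
    (ContinuousLinearMap.proj i)

/-- Every vector w is the jet at t of some polynomial variation, so the vanishing of the defect
tests the two forms on all vectors. -/
theorem momentumForm_chart_change {L : HOTangentBundle E (k + 1) Q → ℝ}
    (hLφ : SmoothOnChart φ hφ L) (hLψ : SmoothOnChart ψ hψ L)
    {γ : ℝ → Q} {t : ℝ} (hγ : SmoothNear E γ t) (h1 : γ t ∈ φ.source) (h2 : γ t ∈ ψ.source) :
    momentumForm φ hφ L γ t = (momentumForm ψ hψ L γ t).comp
      (fderiv ℝ (chart (k := k) ψ hψ ∘ (chart φ hφ).symm)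
        (fun j ↦ iteratedDeriv j (φ ∘ γ) t)) := by
  ext w
  obtain ⟨δ, hδ, hw⟩ := exists_contDiff_iteratedDeriv_eq w t
  obtain rfl : (fun j : Fin (k + 1) ↦ iteratedDeriv j δ t) = w := funext hw
  have h := momentumDefect_eq_zero hLφ hLψ hγ h1 h2 hδ
  rw [momentumDefect, sub_eq_zero, Finset.sum_range, Finset.sum_range] at h
  rw [ContinuousLinearMap.comp_apply, fderiv_transition_variation k hφ hψ hγ h1 h2 hδ,
    momentumForm, momentumForm, sum_apply, sum_apply]
  exact h

end HOTangentBundle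
end ChartChange

/-! ### The Legendre–Ostrogradsky map along a lift, in a fixed chart. -/

section Tulczyjew

variable {E : Type*} [NormedAddCommGroup E] [NormedSpace ℝ E] {k : ℕ}
  {Q : Type*} [TopologicalSpace Q] [ChartedSpace E Q] [IsManifold 𝓘(ℝ, E) ∞ Q]

namespace HOTangentBundle

variable {φ ψ : OpenPartialHomeomorph Q E} {hφ : φ ∈ IsManifold.maximalAtlas 𝓘(ℝ, E) ∞ Q}
  {hψ : ψ ∈ IsManifold.maximalAtlas 𝓘(ℝ, E) ∞ Q}

theorem mdifferentiableAt_chart {x : HOTangentBundle E k Q} (hx : base x ∈ φ.source) :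
    MDifferentiableAt 𝓘(ℝ, Fin (k + 1) → E) 𝓘(ℝ, Fin (k + 1) → E) (chart φ hφ) x :=
  (contMDiffAt_of_mem_maximalAtlas (chart_mem_maximalAtlas φ hφ) hx).mdifferentiableAt (by simp)

/-- The components of a tangent vector in the natural coordinates of the chart `φ`. -/
def tangentCoord (φ : OpenPartialHomeomorph Q E) (hφ : φ ∈ IsManifold.maximalAtlas 𝓘(ℝ, E) ∞ Q)
    (x : HOTangentBundle E k Q) : (Fin (k + 1) → E) →L[ℝ] (Fin (k + 1) → E) :=
  mfderiv 𝓘(ℝ, Fin (k + 1) → E) 𝓘(ℝ, Fin (k + 1) → E) (chart φ hφ) x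

theorem tangentCoord_velocity {γ : ℝ → Q} {t : ℝ} (hγ : SmoothNear E γ t) (ht : γ t ∈ φ.source) :
    tangentCoord φ hφ (lift E k γ t) (velocity 𝓘(ℝ, Fin (k + 1) → E) (lift E k γ) t).2 =
      fun j : Fin (k + 1) ↦ iteratedDeriv (j + 1) (φ ∘ γ) t := by
  have h1 := (mdifferentiableAt_chart (k := k) (hφ := hφ)
    (show base (lift E k γ t) ∈ φ.source by rwa [base_lift])).hasMFDerivAt
  have h2 := (hasMFDerivAt_lift (k := k) hγ).mdifferentiableAt.hasMFDerivAt
  let D : ℝ →L[ℝ] (Fin (k + 1) → E) :=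
    mfderiv 𝓘(ℝ, ℝ) 𝓘(ℝ, Fin (k + 1) → E) (lift E k γ) t
  have h3 : HasFDerivAt (fun s ↦ chart φ hφ (lift E k γ s))
      ((tangentCoord φ hφ (lift E k γ t)).comp D) t :=
    hasMFDerivAt_iff_hasFDerivAt.1 (h1.comp t h2)
  have h4 : HasDerivAt (fun s ↦ fun j : Fin (k + 1) ↦ iteratedDeriv j (φ ∘ γ) s)
      (fun j : Fin (k + 1) ↦ iteratedDeriv (j + 1) (φ ∘ γ) t) t :=
    hasDerivAt_pi.2 fun j ↦ hasDerivAt_iteratedDeriv (hγ.contDiffAt_chart hφ ht) _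
  have h5 := h4.congr_of_eventuallyEq (eventually_coord_lift (k := k) hγ hφ ht)
  exact h3.hasDerivAt.unique h5

theorem tangentCoord_change {x : HOTangentBundle E k Q} (h1 : base x ∈ φ.source)
    (h2 : base x ∈ ψ.source) :
    tangentCoord ψ hψ x = (fderiv ℝ (chart ψ hψ ∘ (chart φ hφ).symm) (chart φ hφ x)).comp
      (tangentCoord φ hφ x) := by
  have hx : x ∈ (chart φ hφ).source := h1
  have d1 := (mdifferentiableAt_chart (k := k) (hφ := hφ) h1).hasMFDerivAt
  have d2 : DifferentiableAt ℝ (chart ψ hψ ∘ (chart φ hφ).symm) (chart φ hφ x) :=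
    (contDiffAt_transition (chart_mem_maximalAtlas φ hφ) (chart_mem_maximalAtlas ψ hψ)
      ((chart φ hφ).map_source hx) (by rw [(chart φ hφ).left_inv hx]; exact h2)).differentiableAt
      (by simp)
  have d3 := d2.hasFDerivAt.hasMFDerivAt.comp x d1
  refine HasMFDerivAt.mfderiv (d3.congr_of_eventuallyEq ?_)
  filter_upwards [(chart φ hφ).open_source.mem_nhds hx] with z hz
  simp [(chart φ hφ).left_inv hz]

theorem mfderiv_coord {x : HOTangentBundle E k Q} (hx : base x ∈ φ.source) (i : Fin (k + 1)) :
    mfderiv 𝓘(ℝ, Fin (k + 1) → E) 𝓘(ℝ, E) (fun y ↦ coord φ y i) x =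
      (ContinuousLinearMap.proj (R := ℝ) (φ := fun _ : Fin (k + 1) ↦ E) i).comp
        (tangentCoord φ hφ x) := by
  have d1 := (mdifferentiableAt_chart (k := k) (hφ := hφ) hx).hasMFDerivAt
  have d2 := (ContinuousLinearMap.proj (R := ℝ) (φ := fun _ : Fin (k + 1) ↦ E) i).hasMFDerivAt
    (x := chart φ hφ x)
  exact (d2.comp x d1).mfderiv

/-- The preferred trivialization of the tangent bundle over `b` in terms of the natural chart. -/
theorem trivializationAt_snd {b y : HOTangentBundle E k Q} {q : Q} (hb : base b = q)
    (hy : base y ∈ (chartAt E q).source) (v : Fin (k + 1) → E) :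
    (trivializationAt (Fin (k + 1) → E)
        (TangentSpace 𝓘(ℝ, Fin (k + 1) → E) (M := HOTangentBundle E k Q)) b ⟨y, v⟩).2 =
      tangentCoord (chartAt E q) (IsManifold.chart_mem_maximalAtlas _) y v := by
  subst hb
  have h := TangentBundle.continuousLinearMapAt_trivializationAt
    (I := 𝓘(ℝ, Fin (k + 1) → E)) (x₀ := b) (x := y) hy
  have h' := congrArg (fun A : (Fin (k + 1) → E) →L[ℝ] (Fin (k + 1) → E) ↦ A v) h
  refine Eq.trans ?_ h'
  refine (congrFun (Bundle.Trivialization.coe_linearMapAt_of_mem _ ?_) _).symm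
  exact hy

theorem legendreOstrogradsky_eq_of_base {L : HOTangentBundle E (k + 1) Q → ℝ}
    {x : HOTangentBundle E (2 * k + 1) Q} {q : Q} (hq : base x = q)
    {y : HOTangentBundle E k Q} (hy : proj (by omega) x = y) :
    legendreOstrogradsky L x = ⟨y, ∑ i : Fin (k + 1),
      (momentum (chartAt E q) (IsManifold.chart_mem_maximalAtlas _) L i x).comp
        (mfderiv 𝓘(ℝ, Fin (k + 1) → E) 𝓘(ℝ, E) (fun y ↦ coord (chartAt E q) y i) y)⟩ := by
  subst hq hy; rfl

theorem sum_comp_proj_comp (L : HOTangentBundle E (k + 1) Q → ℝ) (γ : ℝ → Q) (t : ℝ)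
    (A : (Fin (k + 1) → E) →L[ℝ] (Fin (k + 1) → E)) :
    ∑ i : Fin (k + 1), (ostrogradskySum (k + 1 + 1) (partialAlong φ hφ L γ) (i + 1) t).comp
      ((ContinuousLinearMap.proj (R := ℝ) (φ := fun _ : Fin (k + 1) ↦ E) i).comp A) =
      (momentumForm φ hφ L γ t).comp A := by
  ext w
  simp [momentumForm, sum_apply]

/-- The Legendre–Ostrogradsky map along the lift of a curve, in an arbitrary chart. -/
theorem legendreOstrogradsky_lift {L : HOTangentBundle E (k + 1) Q → ℝ}
    (hL : ContMDiff 𝓘(ℝ, Fin (k + 1 + 1) → E) 𝓘(ℝ, ℝ) ∞ L)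
    (hφ : φ ∈ IsManifold.maximalAtlas 𝓘(ℝ, E) ∞ Q) {γ : ℝ → Q} {t : ℝ} (hγ : SmoothNear E γ t)
    (ht : γ t ∈ φ.source) :
    legendreOstrogradsky L (lift E (2 * k + 1) γ t) =
      ⟨lift E k γ t, (momentumForm φ hφ L γ t).comp (tangentCoord φ hφ (lift E k γ t))⟩ := by
  have hψ : chartAt E (γ t) ∈ IsManifold.maximalAtlas 𝓘(ℝ, E) ∞ Q :=
    IsManifold.chart_mem_maximalAtlas _
  have h2 : γ t ∈ (chartAt E (γ t)).source := mem_chart_source E _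
  rw [legendreOstrogradsky_eq_of_base (base_lift γ t) (proj_lift (by omega) γ t)]
  refine congrArg (Bundle.TotalSpace.mk (lift E k γ t)) ?_
  have h3 : chart φ hφ (lift E k γ t) = fun j : Fin (k + 1) ↦ iteratedDeriv j (φ ∘ γ) t :=
    (eventually_coord_lift hγ hφ ht).self_of_nhds
  -- The map is defined with the preferred chart at γ t, which changes with t. Invariance of the
  -- momentum form replaces it by the fixed chart φ.
  have e1 : (momentumForm φ hφ L γ t).comp (tangentCoord φ hφ (lift E k γ t)) =
      (momentumForm _ hψ L γ t).comp (tangentCoord _ hψ (lift E k γ t)) := by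
    rw [momentumForm_chart_change (smoothOnChart_of_contMDiff hL)
        (smoothOnChart_of_contMDiff hL) hγ ht h2 (hψ := hψ),
      tangentCoord_change (φ := φ) (hφ := hφ) (hψ := hψ) (by rwa [base_lift]) (by rwa [base_lift]),
      h3, ContinuousLinearMap.comp_assoc]
  refine Eq.trans ?_ e1.symm
  rw [← sum_comp_proj_comp]
  refine Finset.sum_congr rfl fun i _ ↦ ?_
  rw [mfderiv_coord (hφ := hψ) (by rwa [base_lift]),
    momentum_lift (smoothOnChart_of_contMDiff hL) hγ h2]
  rfl

end HOTangentBundle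
end Tulczyjew

/-! ### The canonical immersion in coordinates and membership in the Lagrangian submanifold. -/

section Main

variable {E : Type*} [NormedAddCommGroup E] [NormedSpace ℝ E] {k : ℕ}
  {Q : Type*} [TopologicalSpace Q] [ChartedSpace E Q] [IsManifold 𝓘(ℝ, E) ∞ Q]

namespace HOTangentBundle

theorem trivializationAt_self (b : HOTangentBundle E k Q) (v : Fin (k + 1) → E) :
    (trivializationAt (Fin (k + 1) → E)
        (TangentSpace 𝓘(ℝ, Fin (k + 1) → E) (M := HOTangentBundle E k Q)) b ⟨b, v⟩).2 = v :=
  (tangentBundleCore 𝓘(ℝ, Fin (k + 1) → E) (HOTangentBundle E k Q)).coordChange_self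
    (achart _ b) b (mem_achart_source _ b) v

/-- A tangent vector at b is by convention its component vector in the preferred chart at b. -/
theorem tangentCoord_self {b : HOTangentBundle E k Q} {q : Q} (hb : base b = q) :
    tangentCoord (chartAt E q) (IsManifold.chart_mem_maximalAtlas _) b =
      ContinuousLinearMap.id ℝ (Fin (k + 1) → E) := by
  ext v : 1
  rw [← trivializationAt_snd hb (by rw [hb]; exact mem_chart_source E q) v, trivializationAt_self]
  rfl

theorem velocity_lift {γ : ℝ → Q} {t : ℝ} (hγ : SmoothNear E γ t) :
    velocity 𝓘(ℝ, Fin (k + 1) → E) (lift E k γ) t =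
      ⟨lift E k γ t, (fun j ↦ iteratedDeriv (j + 1) (chartAt E (γ t) ∘ γ) t :
        Fin (k + 1) → E)⟩ := by
  refine congrArg (Bundle.TotalSpace.mk (lift E k γ t)) ?_
  rw [(hasMFDerivAt_lift hγ).mfderiv]
  exact one_smul ℝ _

theorem canonicalImmersion_fst (x : HOTangentBundle E (k + 1) Q) :
    (canonicalImmersion x).1 = proj (Nat.le_succ k) x := by
  obtain ⟨γ, hγ, rfl⟩ := exists_lift_eq x
  rw [canonicalImmersion_lift hγ, proj_lift]
  rfl

theorem coord_canonicalImmersion {φ : OpenPartialHomeomorph Q E}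
    (hφ : φ ∈ IsManifold.maximalAtlas 𝓘(ℝ, E) ∞ Q) {x : HOTangentBundle E (k + 1) Q}
    (hx : base x ∈ φ.source) :
    coord φ (canonicalImmersion x).1 = (fun j : Fin (k + 1) ↦ coord φ x j.castSucc) ∧
      tangentCoord φ hφ (canonicalImmersion x).1 (canonicalImmersion x).2 =
        fun j : Fin (k + 1) ↦ coord φ x j.succ := by
  obtain ⟨γ, hγ, rfl⟩ := exists_lift_eq x
  rw [base_lift] at hx
  rw [canonicalImmersion_lift hγ, (eventually_coord_lift hγ hφ hx).self_of_nhds]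
  exact ⟨(eventually_coord_lift hγ hφ hx).self_of_nhds, tangentCoord_velocity hγ hx⟩

/-- The truncated and the shifted coordinates together contain all coordinates of the jet.
Injectivity makes the jet in the definition of `lagrangianSubmanifold` unique. -/
theorem canonicalImmersion_injective :
    Function.Injective (canonicalImmersion : HOTangentBundle E (k + 1) Q → _) := by
  intro x y h
  have hb : base x = base y := by
    have := congrArg (fun v ↦ base v.1) h
    simpa only [canonicalImmersion_fst, base_proj] using this
  have hφ : chartAt E (base x) ∈ IsManifold.maximalAtlas 𝓘(ℝ, E) ∞ Q :=
    IsManifold.chart_mem_maximalAtlas _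
  have hx : base x ∈ (chartAt E (base x)).source := mem_chart_source E _
  have hy : base y ∈ (chartAt E (base x)).source := hb ▸ hx
  have h1 := coord_canonicalImmersion hφ hx
  have h2 := coord_canonicalImmersion hφ hy
  rw [h] at h1
  have e1 := h1.1.symm.trans h2.1
  have e2 := h1.2.symm.trans h2.2
  refine coord_injective hφ hx hy (funext fun j ↦ ?_)
  refine Fin.cases ?_ (fun j ↦ congrFun e2 j) j
  exact congrFun e1 0

variable (E k) in
/-- The canonical immersion in natural coordinates. -/
def truncShift : (Fin (k + 1 + 1) → E) →L[ℝ] (Fin (k + 1) → E) × (Fin (k + 1) → E) :=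
  (ContinuousLinearMap.pi fun j : Fin (k + 1) ↦
      ContinuousLinearMap.proj (R := ℝ) (φ := fun _ : Fin (k + 1 + 1) ↦ E) j.castSucc).prod
    (ContinuousLinearMap.pi fun j : Fin (k + 1) ↦
      ContinuousLinearMap.proj (R := ℝ) (φ := fun _ : Fin (k + 1 + 1) ↦ E) j.succ)

theorem hasMFDerivAt_canonicalImmersion (x : HOTangentBundle E (k + 1) Q) :
    HasMFDerivAt 𝓘(ℝ, Fin (k + 1 + 1) → E) 𝓘(ℝ, Fin (k + 1) → E).tangent
      canonicalImmersion x (truncShift E k) := by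
  have hφ : chartAt E (base x) ∈ IsManifold.maximalAtlas 𝓘(ℝ, E) ∞ Q :=
    IsManifold.chart_mem_maximalAtlas _
  have hx : x ∈ (chart (k := k + 1) _ hφ).source := mem_chart_source E (base x)
  have hb : base (canonicalImmersion x).1 = base x := by rw [canonicalImmersion_fst, base_proj]
  -- In the preferred charts the immersion is itself the linear map `truncShift`, hence equal to its
  -- derivative.
  have key : ∀ z ∈ (chart (k := k + 1) _ hφ).source,
      (chartAt (Fin (k + 1) → E) (canonicalImmersion x).1 (canonicalImmersion z).1,
        (trivializationAt (Fin (k + 1) → E)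
          (TangentSpace 𝓘(ℝ, Fin (k + 1) → E) (M := HOTangentBundle E k Q))
          (canonicalImmersion x).1 (canonicalImmersion z)).2) =
        truncShift E k (chart _ hφ z) := by
    intro z hz
    have hz' : base (canonicalImmersion z).1 ∈ (chartAt E (base x)).source := by
      rw [canonicalImmersion_fst, base_proj]; exact hz
    have h := coord_canonicalImmersion hφ hz
    refine Prod.ext ?_ ?_
    · rw [chartAt_eq_of_base hb]
      exact h.1
    · exact (trivializationAt_snd hb hz' _).trans h.2
  refine ⟨?_, ?_⟩
  · refine (FiberBundle.continuousAt_totalSpace (Fin (k + 1) → E) _).2 ⟨?_, ?_⟩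
    · simp only [canonicalImmersion_fst]
      exact (contMDiff_proj _).continuous.continuousAt
    · have hc : ContinuousAt (fun z ↦ (truncShift E k (chart _ hφ z)).2) x :=
        (continuous_snd.comp (truncShift E k).continuous).continuousAt.comp
          ((chart _ hφ).continuousAt hx)
      refine hc.congr ?_
      filter_upwards [(chart _ hφ).open_source.mem_nhds hx] with z hz
      exact (congrArg Prod.snd (key z hz)).symm
  · rw [modelWithCornersSelf_coe, Set.range_id]
    refine HasFDerivAt.hasFDerivWithinAt ?_
    refine (truncShift E k).hasFDerivAt.congr_of_eventuallyEq ?_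
    have ht : (chart (k := k + 1) _ hφ).target ∈ 𝓝 (extChartAt 𝓘(ℝ, Fin (k + 1 + 1) → E) x x) :=
      (chart (k := k + 1) _ hφ).open_target.mem_nhds ((chart _ hφ).map_source hx)
    filter_upwards [ht] with y hy
    have h := key _ ((chart (k := k + 1) _ hφ).map_target hy)
    rw [(chart _ hφ).right_inv hy] at h
    exact h

theorem mk_mem_lagrangianSubmanifold_iff {L : HOTangentBundle E (k + 1) Q → ℝ}
    {x : HOTangentBundle E (k + 1) Q}
    {v : TangentBundle 𝓘(ℝ, Fin (k + 1) → E) (HOTangentBundle E k Q)}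
    (hv : v = canonicalImmersion x)
    (ν : (Fin (k + 1) → E) × (Fin (k + 1) → E) →L[ℝ] ℝ) :
    (⟨v, ν⟩ : CotangentBundle 𝓘(ℝ, Fin (k + 1) → E).tangent
      (TangentBundle 𝓘(ℝ, Fin (k + 1) → E) (HOTangentBundle E k Q))) ∈
        lagrangianSubmanifold L ↔
      ν.comp (truncShift E k) = mfderiv 𝓘(ℝ, Fin (k + 1 + 1) → E) 𝓘(ℝ, ℝ) L x := by
  subst hv
  constructor
  · rintro ⟨y, ν', h, h'⟩
    obtain rfl : x = y := canonicalImmersion_injective (congrArg Bundle.TotalSpace.proj h)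
    have hν : ν = ν' := by
      injection h
    subst hν
    rw [(hasMFDerivAt_canonicalImmersion x).mfderiv] at h'
    exact h'
  · intro h
    refine ⟨x, ν, rfl, ?_⟩
    rw [(hasMFDerivAt_canonicalImmersion x).mfderiv]
    exact h

theorem mfderiv_lagrangian {L : HOTangentBundle E k Q → ℝ} {x : HOTangentBundle E k Q}
    {q : Q} (hq : base x = q) (hL : MDifferentiableAt 𝓘(ℝ, Fin (k + 1) → E) 𝓘(ℝ, ℝ) L x) :
    mfderiv 𝓘(ℝ, Fin (k + 1) → E) 𝓘(ℝ, ℝ) L x =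
      fderiv ℝ (L ∘ (chart (chartAt E q) (IsManifold.chart_mem_maximalAtlas _)).symm)
        (chart (chartAt E q) (IsManifold.chart_mem_maximalAtlas _) x) := by
  subst hq
  rw [hL.mfderiv, modelWithCornersSelf_coe, Set.range_id, fderivWithin_univ]
  rfl

end HOTangentBundle
end Main

/-! ### The velocity of the Legendre curve and the equivalence. -/

section Main

variable {E : Type*} [NormedAddCommGroup E] [NormedSpace ℝ E] {k : ℕ}
  {Q : Type*} [TopologicalSpace Q] [ChartedSpace E Q] [IsManifold 𝓘(ℝ, E) ∞ Q]

/-- The velocity of a curve of covectors in terms of its local expression. -/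
theorem hasMFDerivAt_covector {F : Type*} [NormedAddCommGroup F] [NormedSpace ℝ F]
    {M : Type*} [TopologicalSpace M] [ChartedSpace F M] [IsManifold 𝓘(ℝ, F) 1 M]
    {x : ℝ → M} {p : ∀ s, TangentSpace 𝓘(ℝ, F) (x s) →L[ℝ] ℝ} {t : ℝ}
    {P : ℝ → F →L[ℝ] ℝ} {x' : F} {P' : F →L[ℝ] ℝ}
    (hx : HasMFDerivAt 𝓘(ℝ, ℝ) 𝓘(ℝ, F) x t (ContinuousLinearMap.toSpanSingleton ℝ x'))
    (hP : HasDerivAt P P' t)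
    (hp : ∀ᶠ s in 𝓝 t, ∀ v : TangentSpace 𝓘(ℝ, F) (x s), p s v =
      P s (trivializationAt F (TangentSpace 𝓘(ℝ, F) (M := M)) (x t) ⟨x s, v⟩).2) :
    HasMFDerivAt 𝓘(ℝ, ℝ) (𝓘(ℝ, F).prod 𝓘(ℝ, F →L[ℝ] ℝ))
      (fun s ↦ (⟨x s, p s⟩ : CotangentBundle 𝓘(ℝ, F) M)) t
      (ContinuousLinearMap.toSpanSingleton ℝ (x', P')) := by
  -- The fibre coordinate of the cotangent bundle is the covector composed with the inverse tangent
  -- trivialization, and by `hp` this is P.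
  have hev : (fun s ↦ ContinuousLinearMap.inCoordinates F (TangentSpace 𝓘(ℝ, F) (M := M)) ℝ
      (fun _ : M ↦ ℝ) (x t) (x s) (x t) (x s) (p s)) =ᶠ[𝓝 t] P := by
    filter_upwards [hp, hx.1.preimage_mem_nhds
      ((trivializationAt F (TangentSpace 𝓘(ℝ, F) (M := M)) (x t)).open_baseSet.mem_nhds
        (FiberBundle.mem_baseSet_trivializationAt' (F := F)
          (E := TangentSpace 𝓘(ℝ, F) (M := M)) (x t)))] with s hs hb
    have hb' : x s ∈ (trivializationAt F (TangentSpace 𝓘(ℝ, F) (M := M)) (x t)).baseSet := hb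
    rw [ContinuousLinearMap.inCoordinates_eq (F := F) (E := TangentSpace 𝓘(ℝ, F) (M := M))
      (F' := ℝ) (E' := fun _ : M ↦ ℝ) (x₀ := x t) (y₀ := x t) (y := x s) (ϕ := p s) hb'
      (Set.mem_univ _)]
    ext w
    let e := (trivializationAt F (TangentSpace 𝓘(ℝ, F) (M := M)) (x t)).continuousLinearEquivAt ℝ
      (x s) hb'
    refine (hs (e.symm w)).trans ?_
    exact congrArg (P s) (e.apply_symm_apply w)
  have hP2 := hP.congr_of_eventuallyEq hev
  have hm : MDifferentiableAt 𝓘(ℝ, ℝ) (𝓘(ℝ, F).prod 𝓘(ℝ, F →L[ℝ] ℝ))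
      (fun s ↦ (⟨x s, p s⟩ : CotangentBundle 𝓘(ℝ, F) M)) t := by
    refine (mdifferentiableAt_hom_bundle (E₁ := TangentSpace 𝓘(ℝ, F) (M := M))
      (E₂ := fun _ : M ↦ ℝ) _).2 ⟨hx.mdifferentiableAt, ?_⟩
    exact hP2.differentiableAt.mdifferentiableAt
  refine ⟨hm.continuousAt, ?_⟩
  have h2 := hx.2
  rw [modelWithCornersSelf_coe, Set.range_id] at h2 ⊢
  have h3 : HasFDerivAt (fun s ↦ chartAt F (x t) (x s))
      (ContinuousLinearMap.toSpanSingleton ℝ x') t := hasFDerivWithinAt_univ.1 h2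
  have h4 : HasFDerivAt _ (ContinuousLinearMap.toSpanSingleton ℝ (x', P')) t :=
    (h3.hasDerivAt.prodMk hP2).hasFDerivAt.congr_fderiv (by ext <;> simp)
  refine HasFDerivAt.hasFDerivWithinAt
    (HasFDerivAt.congr_of_eventuallyEq h4 (Filter.Eventually.of_forall fun s ↦ ?_))
  exact hom_chart (F₁ := F) (F₂ := ℝ) (E₁ := TangentSpace 𝓘(ℝ, F) (M := M))
    (E₂ := fun _ : M ↦ ℝ) ⟨x t, p t⟩ ⟨x s, p s⟩

theorem tulczyjewAlpha_velocity {F : Type*} [NormedAddCommGroup F] [NormedSpace ℝ F]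
    {M : Type*} [TopologicalSpace M] [ChartedSpace F M] [IsManifold 𝓘(ℝ, F) 1 M]
    {c : ℝ → CotangentBundle 𝓘(ℝ, F) M} {t : ℝ} {y : M} {p : F →L[ℝ] ℝ} {x' : F}
    {P' : F →L[ℝ] ℝ} (hct : c t = ⟨y, p⟩)
    (hc : HasMFDerivAt 𝓘(ℝ, ℝ) (𝓘(ℝ, F).prod 𝓘(ℝ, F →L[ℝ] ℝ)) c t
      (ContinuousLinearMap.toSpanSingleton ℝ (x', P'))) :
    tulczyjewAlpha (velocity (𝓘(ℝ, F).prod 𝓘(ℝ, F →L[ℝ] ℝ)) c t) =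
      ⟨⟨y, x'⟩, P'.coprod p⟩ := by
  have key (c₀ : CotangentBundle 𝓘(ℝ, F) M) (h : c₀ = ⟨y, p⟩) :
      tulczyjewAlpha (⟨c₀, (x', P')⟩ :
        TangentBundle (𝓘(ℝ, F).prod 𝓘(ℝ, F →L[ℝ] ℝ)) (CotangentBundle 𝓘(ℝ, F) M)) =
        ⟨⟨y, x'⟩, P'.coprod p⟩ := by
    subst h; rfl
  rw [← key _ hct]
  refine congrArg (fun v ↦ tulczyjewAlpha (Bundle.TotalSpace.mk (c t) v)) ?_
  rw [hc.mfderiv]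
  exact one_smul ℝ (x', P')

namespace HOTangentBundle

theorem hasDerivAt_momentumForm {φ : OpenPartialHomeomorph Q E}
    {hφ : φ ∈ IsManifold.maximalAtlas 𝓘(ℝ, E) ∞ Q} {L : HOTangentBundle E (k + 1) Q → ℝ}
    (hL : SmoothOnChart φ hφ L) {γ : ℝ → Q} {t : ℝ} (hγ : SmoothNear E γ t)
    (ht : γ t ∈ φ.source) :
    HasDerivAt (momentumForm φ hφ L γ)
      (∑ i : Fin (k + 1), (partialAlong φ hφ L γ i t -
        ostrogradskySum (k + 1 + 1) (partialAlong φ hφ L γ) i t).comp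
          (ContinuousLinearMap.proj (R := ℝ) (φ := fun _ : Fin (k + 1) ↦ E) i)) t := by
  refine HasDerivAt.fun_sum fun i _ ↦ ?_
  have h := (hasDerivAt_ostrogradskySum (n := k + 1 + 1) (m := i)
    (contDiffAt_partialAlong hL hγ ht) (by omega)).clm_comp
      (hasDerivAt_const t (ContinuousLinearMap.proj (R := ℝ) (φ := fun _ : Fin (k + 1) ↦ E) i))
  simpa using h

/-- Near t the Legendre curve is the momentum form in the fixed chart at γ t, so pdot comes from the
recursion for S. At t itself `tangentCoord` is the identity, so p is the momentum form. -/
theorem tulczyjewAlpha_velocity_legendreOstrogradsky {L : HOTangentBundle E (k + 1) Q → ℝ}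
    (hL : ContMDiff 𝓘(ℝ, Fin (k + 1 + 1) → E) 𝓘(ℝ, ℝ) ∞ L)
    {γ : ℝ → Q} {t : ℝ} (hγ : SmoothNear E γ t)
    {hφ : chartAt E (γ t) ∈ IsManifold.maximalAtlas 𝓘(ℝ, E) ∞ Q} :
    tulczyjewAlpha (velocity (𝓘(ℝ, Fin (k + 1) → E).prod 𝓘(ℝ, (Fin (k + 1) → E) →L[ℝ] ℝ))
      (fun s ↦ legendreOstrogradsky L (lift E (2 * k + 1) γ s)) t) =
      ⟨velocity 𝓘(ℝ, Fin (k + 1) → E) (lift E k γ) t,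
        (∑ i : Fin (k + 1), (partialAlong _ hφ L γ i t -
          ostrogradskySum (k + 1 + 1) (partialAlong _ hφ L γ) i t).comp
            (ContinuousLinearMap.proj (R := ℝ) (φ := fun _ : Fin (k + 1) ↦ E) i)).coprod
          (momentumForm _ hφ L γ t)⟩ := by
  have ht : γ t ∈ (chartAt E (γ t)).source := mem_chart_source E _
  rw [velocity_lift hγ]
  refine tulczyjewAlpha_velocity ?_ ?_
  · rw [legendreOstrogradsky_lift hL hφ hγ ht, tangentCoord_self (base_lift γ t)]
    rfl
  · have hd := hasMFDerivAt_covector (x := lift E k γ)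
      (p := fun s ↦ (momentumForm _ hφ L γ s).comp (tangentCoord _ hφ (lift E k γ s)))
      (hasMFDerivAt_lift hγ) (hasDerivAt_momentumForm (smoothOnChart_of_contMDiff hL) hγ ht) (by
        filter_upwards [eventually_smoothNear_mem hγ ht] with s hs v
        exact congrArg (momentumForm _ hφ L γ s)
          (trivializationAt_snd (base_lift γ t) (by rw [base_lift]; exact hs.2) v).symm)
    refine hd.congr_of_eventuallyEq ?_
    filter_upwards [eventually_smoothNear_mem hγ ht] with s hs
    exact legendreOstrogradsky_lift hL hφ hs.1 hs.2

/-- At a given time, the Euler–Lagrange equation in the preferred chart is equivalent to the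
membership in the Lagrangian submanifold. -/
theorem tulczyjewAlpha_mem_iff {L : HOTangentBundle E (k + 1) Q → ℝ}
    (hL : ContMDiff 𝓘(ℝ, Fin (k + 1 + 1) → E) 𝓘(ℝ, ℝ) ∞ L)
    {γ : ℝ → Q} {t : ℝ} (hγ : SmoothNear E γ t)
    {hφ : chartAt E (γ t) ∈ IsManifold.maximalAtlas 𝓘(ℝ, E) ∞ Q} :
    tulczyjewAlpha (velocity (𝓘(ℝ, Fin (k + 1) → E).prod 𝓘(ℝ, (Fin (k + 1) → E) →L[ℝ] ℝ))
      (fun s ↦ legendreOstrogradsky L (lift E (2 * k + 1) γ s)) t) ∈ lagrangianSubmanifold L ↔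
      ostrogradskySum (k + 1 + 1) (partialAlong _ hφ L γ) 0 t = 0 := by
  have ht : γ t ∈ (chartAt E (γ t)).source := mem_chart_source E _
  have hc : chart (chartAt E (γ t)) hφ (lift E (k + 1) γ t) =
      fun j : Fin (k + 1 + 1) ↦ iteratedDeriv j (chartAt E (γ t) ∘ γ) t :=
    (eventually_coord_lift hγ hφ ht).self_of_nhds
  rw [tulczyjewAlpha_velocity_legendreOstrogradsky hL hγ (hφ := hφ),
    mk_mem_lagrangianSubmanifold_iff (canonicalImmersion_lift hγ).symm,
    mfderiv_lagrangian (base_lift γ t) (hL.mdifferentiableAt (by simp)), hc]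
  -- The pulled-back covector is dL minus the Euler–Lagrange covector applied to the zeroth
  -- component.
  have key (w : ℕ → E) :
      ((∑ i : Fin (k + 1), (partialAlong _ hφ L γ i t -
          ostrogradskySum (k + 1 + 1) (partialAlong _ hφ L γ) i t).comp
            (ContinuousLinearMap.proj (R := ℝ) (φ := fun _ : Fin (k + 1) ↦ E) i)).coprod
          (momentumForm _ hφ L γ t)).comp (truncShift E k) (fun j ↦ w j) =
        fderiv ℝ (L ∘ (chart (chartAt E (γ t)) hφ).symm)
          (fun j : Fin (k + 1 + 1) ↦ iteratedDeriv j (chartAt E (γ t) ∘ γ) t) (fun j ↦ w j) -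
        ostrogradskySum (k + 1 + 1) (partialAlong _ hφ L γ) 0 t (w 0) := by
    rw [← sum_partialAlong L hγ ht,
      ← telescope_ostrogradsky (k + 1) (fun i ↦ partialAlong _ hφ L γ i t)
        (fun i ↦ ostrogradskySum (k + 1 + 1) (partialAlong _ hφ L γ) i t) w
        (ostrogradskySum_last _ _ _), Finset.sum_add_distrib, Finset.sum_range, Finset.sum_range]
    simp [momentumForm, truncShift, sum_apply]
  constructor
  · intro h
    ext w
    -- Only the zeroth entry enters the Euler–Lagrange term, so a constant sequence suffices.
    have h1 := key fun _ ↦ w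
    rw [h] at h1
    exact sub_eq_self.1 h1.symm
  · intro h
    ext w : 1
    obtain ⟨w, rfl⟩ : ∃ w' : ℕ → E, (fun j : Fin (k + 1 + 1) ↦ w' j) = w :=
      ⟨fun m ↦ if hm : m < k + 1 + 1 then w ⟨m, hm⟩ else 0, funext fun j ↦ dif_pos j.2⟩
    have h1 := key w
    rw [h, zero_apply, sub_zero] at h1
    exact h1

/-- Because the Euler–Lagrange expression is a covector, its vanishing in the preferred chart at γ t
forces it to vanish in every chart around γ t. -/
theorem solvesEulerLagrange_iff {L : HOTangentBundle E (k + 1) Q → ℝ}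
    (hL : ContMDiff 𝓘(ℝ, Fin (k + 1 + 1) → E) 𝓘(ℝ, ℝ) ∞ L)
    {γ : ℝ → Q} {I : Set ℝ} (hγ : ∀ t ∈ I, SmoothNear E γ t) :
    SolvesEulerLagrange L γ I ↔ ∀ t ∈ I, ostrogradskySum (k + 1 + 1)
      (partialAlong (chartAt E (γ t)) (IsManifold.chart_mem_maximalAtlas _) L γ) 0 t = 0 := by
  simp only [SolvesEulerLagrange, sum_eulerLagrange]
  refine ⟨fun h t ht ↦ h _ _ t ht (mem_chart_source E _), fun h φ hφ t ht hs ↦ ?_⟩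
  rw [eulerLagrange_chart_change (smoothOnChart_of_contMDiff hL) (smoothOnChart_of_contMDiff hL)
    (hγ t ht) hs (mem_chart_source E (γ t)) (hψ := IsManifold.chart_mem_maximalAtlas _), h t ht,
    ContinuousLinearMap.zero_comp]

end HOTangentBundle
end Main

end HigherOrder

end

theorem mainTheorem4 {E : Type*} [NormedAddCommGroup E] [NormedSpace ℝ E] [FiniteDimensional ℝ E]
    {Q : Type*} [TopologicalSpace Q] [T2Space Q] [SecondCountableTopology Q] [ChartedSpace E Q]
    [IsManifold 𝓘(ℝ, E) ∞ Q] (k : ℕ) (L : HOTangentBundle E (k + 1) Q → ℝ)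
    (hL : ContMDiff 𝓘(ℝ, Fin (k + 1 + 1) → E) 𝓘(ℝ, ℝ) ∞ L)
    (I : Set ℝ) (hI : IsOpen I) (γ : ℝ → Q) (hγ : ContMDiffOn 𝓘(ℝ, ℝ) 𝓘(ℝ, E) ∞ γ I) :
    SolvesEulerLagrange L γ I ↔
      ∀ t ∈ I, tulczyjewAlpha
        (velocity (𝓘(ℝ, Fin (k + 1) → E).prod 𝓘(ℝ, (Fin (k + 1) → E) →L[ℝ] ℝ))
          (fun s ↦ legendreOstrogradsky L (lift E (2 * k + 1) γ s)) t) ∈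
        lagrangianSubmanifold L := by
  have hs : ∀ t ∈ I, SmoothNear E γ t := fun t ht ↦ by
    filter_upwards [hI.mem_nhds ht] with s hs
    exact hγ.contMDiffAt (hI.mem_nhds hs)
  rw [solvesEulerLagrange_iff hL hs]
  exact forall₂_congr fun t ht ↦ (tulczyjewAlpha_mem_iff hL (hs t ht)).symm
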